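/- **Setting.** Let $0=\lambda_0<\lambda_1<\dots<\lambda_{m_0}<\lambda_{m_0+1}=1$ be fixed, with break dates $T_j=\lfloor T\lambda_j\rfloor$. Let $\{V_{t,T}\}_{t=1}^T$ ($T\ge1$) be a real segmented locally stationary process with $m_0+1$ regimes: for $T_{j-1}<t\le T_j$, $$V_{t,T}=\mu_j(t/T)+\int_{-\pi}^{\pi}e^{i\omega t}A^0_{j,t,T}(\omega)\,d\xi(\omega),$$ where: - $\xi$ is a process on $[-\pi,\pi]$ with $\overline{d\xi(\omega)}=d\xi(-\omega)$ and $\mathrm{cum}\{d\xi(\omega_1),\dots,d\xi(\omega_r)\}=\zeta(\sum_j\omega_j)\,g_r(\omega_1,\dots,\omega_{r-1})\,d\omega_1\cdots d\omega_r$ for all $r\ge1$. Here $\zeta$ is the $2\pi$-periodic extension of the Dirac delta, $g_1=0$, $g_2=1$ and $|g_r|\le M_r<\infty$. The stochastic integral is the mean-square limit of integrals of step functions. - There is a function $A(u,\omega)$, $u\in(0,1]$, $\omega\in\mathbb R$, that is continuous on each $(\lambda_{j-1},\lambda_j]\times\mathbb R$, $2\pi$-periodic in $\omega$ and satisfies $A(u,-\omega)=\overline{A(u,\omega)}$.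 There is a $K<\infty$ with $|A^0_{j,t,T}(\omega)-A(t/T,\omega)|\le K/T$ for all $T$, all $T_{j-1}<t\le T_j$ and all $\omega$. - $\mu(u)=\mu_j(u)$ for $u\in(\lambda_{j-1},\lambda_j]$ is piecewise Lipschitz on each regime. Assume further that $A$ is twice continuously differentiable in $u$ for $u\ne\lambda_j$ and twice left-differentiable in $u$ at $u=\lambda_j$ ($1\le j\le m_0+1$), with uniformly bounded first and second (left-)derivatives, the second being Lipschitz in $u$ on each regime; and that $A$ is Lipschitz in $\omega$, uniformly in $u$. Put $f(u,\omega)=|A(u,\omega)|^2$. Let $n_T$ be even integers with $n_T\to\infty$ and $n_T/T\to0$. Let $u=u_T\in(0,1)$ be a fixed point or a sequence for which the window $W_T=[a_T,\dots,b_T]$, $a_T=\lfloor Tu\rfloor-n_T/2+1$, $b_T=\lfloor Tu\rfloor+n_T/2$, lies in $[1,T]$ for all large $T$ (this is automatic for fixed $u$). Let $$I_{L,T}(u,\omega)=\Big|\frac1{\sqrt{n_T}}\sum_{s=0}^{n_T-1}V_{a_T+s,T}\,e^{-i\omega s}\Big|^2,\qquad \omega_l=\frac{2\pi l}{n_T}\in(-\pi,\pi),\quad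 l\not\equiv0\ (\mathrm{mod}\ n_T).$$ We say that *$\mathbb E I_{L,T}(u,\omega_l)\ge f(u,\omega_l)$ as $\omega_l\to0$* if, for every sequence $l=l_T$ of such indices with $\omega_{l}\to0$, (1) $\liminf_{T\to\infty}\big(\mathbb E I_{L,T}(u,\omega_{l})-f(u,\omega_{l})\big)\ge0$, and (2) if $\liminf_{T\to\infty}f(u,0)>0$, then $\mathbb E I_{L,T}(u,\omega_{l})\ge f(u,\omega_{l})$ for all large $T$. **Theorem.** (i) If, for all large $T$, $T_j\notin W_T$ for every $j=1,\dots,m_0$, then $\mathbb E I_{L,T}(u,\omega_l)\ge f(u,\omega_l)$ as $\omega_l\to0$. (ii) Let $1\le j\le m_0$ and suppose that $T_j\in W_T$ for all large $T$. (a) Suppose that $(T_j-a_T)/n_T\to\gamma$ or $(b_T+1-T_j)/n_T\to\gamma$ with $\gamma\in(0,1)$. Suppose also that there are pairwise distinct real constants $B_1,\dots,B_{m_0+1}$, independent of $T$, such that for all large $T$, for every $i\in\{1,\dots,m_0\}$ with $T_i\in W_T$ and all $\omega_l$ as above, $$\Big|\sum_{s=0}^{n_T-1}\mu\Big(\frac{a_T+s}{T}\Big)e^{-i\omega_ls}\Big|^2\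 \ge\ \Big|B_i\sum_{s=0}^{T_i-a_T}e^{-i\omega_ls}+B_{i+1}\sum_{s=T_i-a_T+1}^{n_T-1}e^{-i\omega_ls}\Big|^2 .$$ Then $\mathbb E I_{L,T}(u,\omega_l)\to\infty$ for many sequences $\omega_l\to0$ with $n_T\omega_l^2\to0$, in the following sense. - For every fixed integer $l$ with $l\gamma\notin\mathbb Z$, $\mathbb E I_{L,T}(u,\omega_l)\to\infty$. - For every sequence $l=l_T$ of indices as above with $n_T\omega_{l}^2\to0$ for which the distance of $l_T(T_j-a_T)/n_T$ to $\mathbb Z$ is eventually bounded away from $0$, $\mathbb E I_{L,T}(u,\omega_{l})\to\infty$. - For every sequence $l=l_T$ with $l_T$ and $l_T+1$ both indices as above and $n_T\omega_{l}^2\to0$, $\max\{\mathbb E I_{L,T}(u,\omega_{l}),\ \mathbb E I_{L,T}(u,\omega_{l+1})\}\to\infty$. (b) If $(T_j-a_T)/n_T\to0$ or $(b_T+1-T_j)/n_T\to0$, then $\mathbb E I_{L,T}(u,\omega_l)\ge f(u,\omega_l)$ as $\omega_l\to0$. -/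

import Mathlib

open Filter Topology MeasureTheory
open scoped ENNReal

noncomputable section

namespace LocalPeriodogram

variable {Ω : Type*} [MeasurableSpace Ω]

/-! ### Joint cumulants and the driving spectral process -/

/-- The joint cumulant `cum(X₁, …, X_r)` of complex random variables, through the moment formula
`∑_π (-1)^(|π|-1) (|π|-1)! ∏_{b ∈ π} E ∏_{i ∈ b} X_i`, the sum running over all partitions `π` of
the index set. -/
def jointCumulant (P : Measure Ω) {r : ℕ} (X : Fin r → Ω → ℂ) : ℂ :=
  ∑ p : Finpartition (Finset.univ : Finset (Fin r)),
    (-1 : ℂ) ^ (p.parts.card - 1) * ((p.parts.card - 1).factorial : ℂ) *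
      ∏ b ∈ p.parts, ∫ ω, ∏ i ∈ b, X i ω ∂P

/-- A complex process `ξ` on `[-π, π]` with all moments finite whose increments satisfy
`dξ(-λ) = conj dξ(λ)` and
`cum{dξ(λ₁), …, dξ(λ_r)} = ζ(λ₁ + ⋯ + λ_r) g_r(λ₁, …, λ_{r-1}) dλ₁ ⋯ dλ_r`,
where `ζ` is the `2π`-periodic extension of the Dirac delta, `g₁ = 0`, `g₂ = 1` and `|g_r| ≤ M_r`.
The cumulant identity is written in integrated form, on increments over intervals
`(a_i, b_i] ⊆ [-π, π]`: integrating out the last variable against the Dirac comb leaves the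
constraint that `-(λ₁ + ⋯ + λ_{r-1})` lies in `(a_r, b_r]` modulo `2π`.  Here `g q` is the
function `g_r` with `r = q + 1`. -/
structure IsSpectralProcess (P : Measure Ω) (ξ : ℝ → Ω → ℂ) : Prop where
  memLp : ∀ a ∈ Set.Icc (-Real.pi) Real.pi, ∀ b ∈ Set.Icc (-Real.pi) Real.pi, ∀ p : ℕ,
    MemLp (fun ω => ξ b ω - ξ a ω) (p : ℝ≥0∞) P
  conj_increment : ∀ a ∈ Set.Icc (-Real.pi) Real.pi, ∀ b ∈ Set.Icc (-Real.pi) Real.pi,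
    ∀ᵐ ω ∂P, (starRingEnd ℂ) (ξ b ω - ξ a ω) = ξ (-a) ω - ξ (-b) ω
  cumulant : ∃ (g : (q : ℕ) → (Fin q → ℝ) → ℂ) (M : ℕ → ℝ),
    (∀ q, Measurable (g q)) ∧
    (∀ x, g 0 x = 0) ∧
    (∀ x, g 1 x = 1) ∧
    (∀ q x, ‖g q x‖ ≤ M q) ∧
    ∀ (q : ℕ) (a b : Fin (q + 1) → ℝ), (∀ i, -Real.pi ≤ a i ∧ a i ≤ b i ∧ b i ≤ Real.pi) →
      jointCumulant P (fun i ω => ξ (b i) ω - ξ (a i) ω) =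
        ∫ x in {x : Fin q → ℝ |
            (∀ i : Fin q, x i ∈ Set.Ioc (a i.castSucc) (b i.castSucc)) ∧
            ∃ k : ℤ, 2 * Real.pi * (k : ℝ) - ∑ i, x i
              ∈ Set.Ioc (a (Fin.last q)) (b (Fin.last q))},
          g q x

/-! ### The stochastic integral with respect to the spectral process -/

/-- A complex step function `∑ i, c_i 1_{(a_i, b_i]}` on `[-π, π]`. -/
structure StepFun where
  k : ℕ
  c : Fin k → ℂ
  a : Fin k → ℝ
  b : Fin k → ℝ
  le : ∀ i, -Real.pi ≤ a i ∧ a i ≤ b i ∧ b i ≤ Real.pi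

/-- The values of a step function. -/
def StepFun.eval (S : StepFun) (x : ℝ) : ℂ :=
  ∑ i, (Set.Ioc (S.a i) (S.b i)).indicator (fun _ => S.c i) x

/-- The elementary integral `∑ i, c_i (ξ(b_i) - ξ(a_i))` of a step function. -/
def StepFun.integral (S : StepFun) (ξ : ℝ → Ω → ℂ) (ω : Ω) : ℂ :=
  ∑ i, S.c i * (ξ (S.b i) ω - ξ (S.a i) ω)

/-- `X = ∫_{-π}^{π} h(λ) dξ(λ)`: the function `h` is square integrable on `[-π, π]`, and `X` is the
mean-square limit of the elementary integrals of step functions that converge to `h` in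
`L²([-π, π])`. -/
def IsSpectralIntegral (P : Measure Ω) (ξ : ℝ → Ω → ℂ) (h : ℝ → ℂ) (X : Ω → ℂ) : Prop :=
  MemLp h 2 (volume.restrict (Set.Icc (-Real.pi) Real.pi)) ∧ MemLp X 2 P ∧
  ∃ S : ℕ → StepFun,
    Tendsto (fun N => eLpNorm (fun x => (S N).eval x - h x) 2
      (volume.restrict (Set.Icc (-Real.pi) Real.pi))) atTop (𝓝 0) ∧
    Tendsto (fun N => eLpNorm (fun ω => (S N).integral ξ ω - X ω) 2 P) atTop (𝓝 0)

/-! ### Regimes and segmented locally stationary processes -/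

/-- Break fractions `0 = λ₀ < λ₁ < ⋯ < λ_{m₀} < λ_{m₀+1} = 1`; the breaks proper are
`λ₁, …, λ_{m₀}`. -/
structure IsBreakFractions {m₀ : ℕ} (lam : Fin (m₀ + 2) → ℝ) : Prop where
  zero : lam 0 = 0
  one : lam (Fin.last (m₀ + 1)) = 1
  strictMono : StrictMono lam

/-- The `j`-th regime `(λ_{j-1}, λ_j]` in rescaled time; `j : Fin (m₀ + 1)` counts from zero. -/
def regime {m₀ : ℕ} (lam : Fin (m₀ + 2) → ℝ) (j : Fin (m₀ + 1)) : Set ℝ :=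
  Set.Ioc (lam j.castSucc) (lam j.succ)

/-- The break dates `⌊T λ_j⌋`, `j = 1, …, m₀`; here `j : Fin m₀` counts from zero and separates
the regimes `j.castSucc` and `j.succ`. -/
def breakDate {m₀ : ℕ} (lam : Fin (m₀ + 2) → ℝ) (T : ℕ) (j : Fin m₀) : ℤ :=
  ⌊(T : ℝ) * lam j.succ.castSucc⌋

/-- `f` is piecewise Lipschitz on `s`: away from finitely many points of `ℝ` it satisfies a
Lipschitz bound on every interval of `s` that avoids these points. -/
def PiecewiseLipschitzOn (f : ℝ → ℝ) (s : Set ℝ) : Prop :=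
  ∃ (F : Finset ℝ) (L : ℝ), ∀ x ∈ s, ∀ y ∈ s, x ≤ y → (∀ p ∈ F, p ∉ Set.Icc x y) →
    |f y - f x| ≤ L * (y - x)

/-- `{V_{t,T}}` is segmented locally stationary with `m₀ + 1` regimes, transfer function `A0` (where
`A0 T t` stands for `A⁰_{j,t,T}`, the index `j` being the regime of `t`), limiting transfer
function `A` and trend `mu`.  The functions `A` and `mu` on `(0, 1]` collect the regime-wise
functions: `A_j` and `μ_j` are their restrictions to the `j`-th regime.  If `t` lies in
`(⌊T λ_{j-1}⌋, ⌊T λ_j⌋]` then `t / T` lies in the `j`-th regime. -/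
structure IsSLS (P : Measure Ω) (V : ℕ → ℤ → Ω → ℝ) {m₀ : ℕ} (lam : Fin (m₀ + 2) → ℝ)
    (A0 : ℕ → ℤ → ℝ → ℂ) (A : ℝ → ℝ → ℂ) (mu : ℝ → ℝ) : Prop where
  breaks : IsBreakFractions lam
  representation : ∃ ξ : ℝ → Ω → ℂ, IsSpectralProcess P ξ ∧
    ∀ (T : ℕ) (t : ℤ), 1 ≤ t → t ≤ T →
      IsSpectralIntegral P ξ
        (fun x => Complex.exp (Complex.I * (x : ℂ) * (t : ℂ)) * A0 T t x)
        (fun ω => ((V T t ω - mu ((t : ℝ) / (T : ℝ)) : ℝ) : ℂ))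
  piecewise_continuous : ∀ j : Fin (m₀ + 1),
    ContinuousOn (fun p : ℝ × ℝ => A p.1 p.2) (regime lam j ×ˢ Set.univ)
  periodic : ∀ v ∈ Set.Ioc (0 : ℝ) 1, Function.Periodic (A v) (2 * Real.pi)
  hermitian : ∀ v ∈ Set.Ioc (0 : ℝ) 1, ∀ x, A v (-x) = (starRingEnd ℂ) (A v x)
  approx : ∃ K : ℝ, ∀ (T : ℕ) (t : ℤ), 1 ≤ t → t ≤ T →
    ∀ x ∈ Set.Icc (-Real.pi) Real.pi, ‖A0 T t x - A ((t : ℝ) / (T : ℝ)) x‖ ≤ K / (T : ℝ)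
  trend : ∀ j : Fin (m₀ + 1), PiecewiseLipschitzOn mu (regime lam j)

/-- Smoothness of the limiting transfer function: `A(u, ω)` is twice continuously differentiable in
`u` away from `λ₁, …, λ_{m₀+1}` and twice left-differentiable in `u` at these points, with uniformly
bounded first and second (left) derivatives, the second being Lipschitz in `u` on each regime; and
`A(u, ω)` is Lipschitz in `ω`.  `A1` and `A2` are the first and second (left) derivatives. -/
def SmoothTransfer {m₀ : ℕ} (lam : Fin (m₀ + 2) → ℝ) (A : ℝ → ℝ → ℂ) : Prop :=
  (∃ A1 A2 : ℝ → ℝ → ℂ,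
    (∀ j : Fin (m₀ + 1), ∀ v ∈ Set.Ioo (lam j.castSucc) (lam j.succ), ∀ x,
      HasDerivAt (fun w => A w x) (A1 v x) v ∧ HasDerivAt (fun w => A1 w x) (A2 v x) v ∧
        ContinuousAt (fun w => A2 w x) v) ∧
    (∀ j : Fin (m₀ + 1), ∀ x,
      HasDerivWithinAt (fun w => A w x) (A1 (lam j.succ) x) (Set.Iic (lam j.succ)) (lam j.succ) ∧
      HasDerivWithinAt (fun w => A1 w x) (A2 (lam j.succ) x) (Set.Iic (lam j.succ)) (lam j.succ)) ∧
    (∃ M : ℝ, ∀ v ∈ Set.Ioc (0 : ℝ) 1, ∀ x, ‖A1 v x‖ ≤ M ∧ ‖A2 v x‖ ≤ M) ∧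
    (∀ x, ∃ L : ℝ, ∀ j : Fin (m₀ + 1), ∀ v ∈ regime lam j, ∀ w ∈ regime lam j,
      ‖A2 v x - A2 w x‖ ≤ L * |v - w|)) ∧
  (∃ L : ℝ, ∀ v ∈ Set.Ioc (0 : ℝ) 1, ∀ x y, ‖A v x - A v y‖ ≤ L * |x - y|)

/-- The time-varying spectral density `f(u, ω) = |A(u, ω)|²`. -/
def specDensity (A : ℝ → ℝ → ℂ) (v x : ℝ) : ℝ := ‖A v x‖ ^ 2

/-! ### The local periodogram -/

/-- The first date `⌊Tu⌋ - n/2 + 1` of the window of (even) length `n` around `⌊Tu⌋`. -/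
def windowStart (T n : ℕ) (v : ℝ) : ℤ := ⌊(T : ℝ) * v⌋ - ((n / 2 : ℕ) : ℤ) + 1

/-- The window `[⌊Tu⌋ - n/2 + 1, …, ⌊Tu⌋ + n/2]`. -/
def window (T n : ℕ) (v : ℝ) : Set ℤ :=
  Set.Icc (windowStart T n v) (⌊(T : ℝ) * v⌋ + ((n / 2 : ℕ) : ℤ))

/-- The Fourier frequency `ω_l = 2πl/n`. -/
def fourierFreq (n : ℕ) (l : ℤ) : ℝ := 2 * Real.pi * (l : ℝ) / (n : ℝ)

/-- The admissible indices: `l ≢ 0 (mod n)` and `ω_l ∈ (-π, π)`. -/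
def Admissible (n : ℕ) (l : ℤ) : Prop :=
  ¬ ((n : ℤ) ∣ l) ∧ fourierFreq n l ∈ Set.Ioo (-Real.pi) Real.pi

/-- The local periodogram
`I_{L,T}(u, x) = |n^{-1/2} ∑_{s=0}^{n-1} V_{⌊Tu⌋ - n/2 + s + 1, T} exp(-i x s)|²`. -/
def localPeriodogram (V : ℕ → ℤ → Ω → ℝ) (T n : ℕ) (v x : ℝ) (ω : Ω) : ℝ :=
  ‖(1 / (Real.sqrt (n : ℝ) : ℂ)) * ∑ s ∈ Finset.range n,
    (V T (windowStart T n v + (s : ℤ)) ω : ℂ) * Complex.exp (-Complex.I * (x : ℂ) * (s : ℂ))‖ ^ 2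

/-- The expectation `E I_{L,T}(u, x)`. -/
def meanLocalPeriodogram (P : Measure Ω) (V : ℕ → ℤ → Ω → ℝ) (T n : ℕ) (v x : ℝ) : ℝ :=
  ∫ ω, localPeriodogram V T n v x ω ∂P

/-- The condition on the trend at a break, for the windows around `⌊T u_T⌋`: there are pairwise
different constants `B_1, …, B_{m₀+1}`, not depending on `T`, such that for all large `T`, whenever
the break date `T_j` lies in the window, for all Fourier frequencies
`|∑_s μ((⌊Tu⌋ - n/2 + s + 1)/T) e^{-iω_l s}|²
  ≥ |B_j ∑_{s ≤ T_j - (⌊Tu⌋ - n/2 + 1)} e^{-iω_l s}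
      + B_{j+1} ∑_{s > T_j - (⌊Tu⌋ - n/2 + 1)} e^{-iω_l s}|²`, where `0 ≤ s < n`. -/
def LocalMeanCondition {m₀ : ℕ} (lam : Fin (m₀ + 2) → ℝ) (mu : ℝ → ℝ) (n : ℕ → ℕ) (u : ℕ → ℝ) :
    Prop :=
  ∃ B : Fin (m₀ + 1) → ℝ, Function.Injective B ∧
    ∀ᶠ T : ℕ in atTop, ∀ j : Fin m₀, breakDate lam T j ∈ window T (n T) (u T) →
      ∀ l : ℤ, Admissible (n T) l →
        ‖∑ s ∈ Finset.range (n T),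
            ((if windowStart T (n T) (u T) + (s : ℤ) ≤ breakDate lam T j
              then B j.castSucc else B j.succ : ℝ) : ℂ) *
              Complex.exp (-Complex.I * (fourierFreq (n T) l : ℂ) * (s : ℂ))‖ ^ 2
          ≤ ‖∑ s ∈ Finset.range (n T),
            (mu (((windowStart T (n T) (u T) + (s : ℤ) : ℤ) : ℝ) / (T : ℝ)) : ℂ) *
              Complex.exp (-Complex.I * (fourierFreq (n T) l : ℂ) * (s : ℂ))‖ ^ 2

/-- The position `(T_j - (⌊Tu⌋ - n/2 + 1)) / n` of the break date `T_j` in the window, measured from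
the left end. -/
def leftPosition {m₀ : ℕ} (lam : Fin (m₀ + 2) → ℝ) (T n : ℕ) (v : ℝ) (j : Fin m₀) : ℝ :=
  ((breakDate lam T j - windowStart T n v : ℤ) : ℝ) / (n : ℝ)

/-- The position `((⌊Tu⌋ + n/2 + 1) - T_j) / n` of the break date `T_j` in the window, measured from
the right end. -/
def rightPosition {m₀ : ℕ} (lam : Fin (m₀ + 2) → ℝ) (T n : ℕ) (v : ℝ) (j : Fin m₀) : ℝ :=
  ((⌊(T : ℝ) * v⌋ + ((n / 2 : ℕ) : ℤ) + 1 - breakDate lam T j : ℤ) : ℝ) / (n : ℝ)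

/-- `E I_{L,T}(u, ω_l) ≥ f(u, ω_l)` as `ω_l → 0`: along every sequence of admissible Fourier
frequencies that tends to zero, the inequality holds up to an `o(1)` term, and it holds as it stands
for all large `T` when the spectral density at frequency zero stays away from zero. -/
def BoundedBelowBySpecDensity (P : Measure Ω) (V : ℕ → ℤ → Ω → ℝ) (A : ℝ → ℝ → ℂ)
    (n : ℕ → ℕ) (u : ℕ → ℝ) : Prop :=
  ∀ l : ℕ → ℤ, (∀ᶠ T in atTop, Admissible (n T) (l T)) →
    Tendsto (fun T => fourierFreq (n T) (l T)) atTop (𝓝 0) →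
    (∀ ε > 0, ∀ᶠ T in atTop, specDensity A (u T) (fourierFreq (n T) (l T)) - ε ≤
      meanLocalPeriodogram P V T (n T) (u T) (fourierFreq (n T) (l T))) ∧
    ((∃ c > 0, ∀ᶠ T in atTop, c ≤ specDensity A (u T) 0) →
      ∀ᶠ T in atTop, specDensity A (u T) (fourierFreq (n T) (l T)) ≤
        meanLocalPeriodogram P V T (n T) (u T) (fourierFreq (n T) (l T)))

end LocalPeriodogram

end

/-! The Fourier transform of the window is a deterministic trend transform plus the stochastic
integral of the kernel H(y) = ∑_s A⁰(y) e^{-ixs} e^{iy(a+s)}. The integral is centred and isometric,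
so E I = (|trend transform|² + ‖H‖²) / n exactly, with the norm of L²[-π, π]
(`IsSLS.meanLocalPeriodogram_eq`). Both terms are nonnegative: the comparison with f keeps only the
second, the divergence only the first.

Comparison with f. Suppose that the window lies in the regime of u up to o(n) dates at its ends.
Then H differs from A(u, x) D, with D the Dirichlet kernel centred at x, by o(√n) in norm
(`IsSLS.lpNorm_windowKernel_ge`): slow variation in time is absorbed by summation by parts, the end
pieces cost the square root of their length, and the Lipschitz bound in frequency cancels the peak
of D. As ‖D‖² = 2πn, this gives √(E I) ≥ √(2π) (|A(u, x)| - o(1)). Since f = |A|² carries no factor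
1/(2π), the surplus √(2π) ≥ 2 absorbs the error whenever |A| is at least twice as large as it;
otherwise f itself is o(1) (`IsSLS.boundedBelow_of_pieces`).

Divergence. At a nonzero Fourier frequency the sum of e^{-iωs} over the full window is zero, so a
level jump from b to c after k dates has transform (b - c) ∑_{s<k} e^{-iωs}, of modulus |b - c|
|sin(πlk/n)| / |sin(ω/2)|. Hence E I is at least a constant times ε²/(nω²), where ε bounds from
below the distance of lk/n to the integers (`IsSLS.meanLocalPeriodogram_ge_of_jump`). For two
neighbouring indices, lk/n and (l+1)k/n cannot both be near integers, since their difference k/n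
tends to γ in (0, 1). -/

namespace LocalPeriodogram

/-! ### Mean and covariance of the increments of the spectral process -/

section Increments

variable {Ω : Type*} [MeasurableSpace Ω] {P : Measure Ω}

lemma jointCumulant_one (X : Fin 1 → Ω → ℂ) : jointCumulant P X = ∫ ω, X 0 ω ∂P := by
  have hparts : ∀ p : Finpartition (Finset.univ : Finset (Fin 1)), p.parts = {Finset.univ} := by
    intro p
    have h : ∀ b ∈ p.parts, b = Finset.univ := by
      intro b hb
      obtain ⟨i, hi⟩ := p.nonempty_of_mem_parts hb
      ext k
      rw [Subsingleton.elim k i]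
      exact iff_of_true hi (Finset.mem_univ _)
    exact Finset.eq_singleton_iff_nonempty_unique_mem.2
      ⟨p.parts_nonempty Finset.univ_nonempty.ne_empty, h⟩
  have : Subsingleton (Finpartition (Finset.univ : Finset (Fin 1))) :=
    ⟨fun p q => Finpartition.ext (by rw [hparts p, hparts q])⟩
  unfold jointCumulant
  rw [Fintype.sum_subsingleton _ (⊤ : Finpartition (Finset.univ : Finset (Fin 1)))]
  simp [hparts]

/-- Every partition of a two-point set other than the one-block partition contains a singleton
block, and its factor is a mean, hence zero. -/
lemma jointCumulant_two (X : Fin 2 → Ω → ℂ) (h0 : ∀ i, ∫ ω, X i ω ∂P = 0) :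
    jointCumulant P X = ∫ ω, X 0 ω * X 1 ω ∂P := by
  have hparts : (⊤ : Finpartition (Finset.univ : Finset (Fin 2))).parts = {Finset.univ} := by
    rw [Finset.eq_singleton_iff_nonempty_unique_mem]
    refine ⟨Finpartition.parts_nonempty _ Finset.univ_nonempty.ne_empty, fun b hb => ?_⟩
    have := Finpartition.parts_top_subset (Finset.univ : Finset (Fin 2)) hb
    simpa using this
  unfold jointCumulant
  rw [Finset.sum_eq_single (⊤ : Finpartition (Finset.univ : Finset (Fin 2)))]
  · rw [hparts]; simp [Fin.prod_univ_two]
  · intro p _ hp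
    have hne : Finset.univ ∉ p.parts := by
      intro hu
      apply hp
      refine Finpartition.ext ?_
      rw [hparts, Finset.eq_singleton_iff_unique_mem]
      refine ⟨hu, fun b hb => ?_⟩
      obtain ⟨i, hi⟩ := p.nonempty_of_mem_parts hb
      exact p.eq_of_mem_parts hb hu hi (Finset.mem_univ i)
    obtain ⟨b, hb⟩ := p.parts_nonempty Finset.univ_nonempty.ne_empty
    obtain ⟨i, hi⟩ := p.nonempty_of_mem_parts hb
    have hbi : b = {i} := by
      by_contra hbi
      apply hne
      have : b = Finset.univ := by
        obtain ⟨k, hk, hki⟩ : ∃ k ∈ b, k ≠ i := by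
          by_contra! hcon
          exact hbi (Finset.eq_singleton_iff_unique_mem.2 ⟨hi, hcon⟩)
        ext m
        simp only [Finset.mem_univ, iff_true]
        have : m = i ∨ m = k := by omega
        rcases this with rfl | rfl <;> assumption
      exact this ▸ hb
    rw [Finset.prod_eq_zero hb, mul_zero]
    simp [hbi, h0]
  · simp

variable {ξ : ℝ → Ω → ℂ}

lemma IsSpectralProcess.integral_increment (hξ : IsSpectralProcess P ξ) {a b : ℝ}
    (ha : -Real.pi ≤ a) (hab : a ≤ b) (hb : b ≤ Real.pi) :
    ∫ ω, (ξ b ω - ξ a ω) ∂P = 0 := by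
  obtain ⟨g, M, -, h0, -, -, hc⟩ := hξ.cumulant
  have := hc 0 (fun _ => a) (fun _ => b) (fun _ => ⟨ha, hab, hb⟩)
  rw [jointCumulant_one] at this
  simpa [h0] using this

/-- Inside [-π, π] only k = 0 contributes, apart from the point y = π reached by k = 1. For k = 0
the reflection turns (-d, -c] into [c, d), which differs from (c, d] at its endpoints only. -/
lemma reflected_interval_ae_eq {a b c d : ℝ} (ha : -Real.pi ≤ a) (hb : b ≤ Real.pi)
    (hc : -Real.pi ≤ c) (hd : d ≤ Real.pi) :
    ({y : ℝ | y ∈ Set.Ioc a b ∧ ∃ k : ℤ, 2 * Real.pi * (k : ℝ) - y ∈ Set.Ioc (-d) (-c)} : Set ℝ)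
      =ᵐ[volume] (Set.Ioc a b ∩ Set.Ioc c d : Set ℝ) := by
  have hpi := Real.pi_pos
  have hnull : ∀ x : ℝ, ∀ᵐ y : ℝ, y ≠ x := fun x => by
    simp [ae_iff]
  filter_upwards [hnull Real.pi, hnull c, hnull d] with y h1 h2 h3
  refine propext ⟨?_, ?_⟩
  · rintro ⟨⟨hy1, hy2⟩, k, hk1, hk2⟩
    have hk : k = 0 := by
      rcases lt_trichotomy k 0 with h | h | h
      · have : (k : ℝ) ≤ -1 := by exact_mod_cast (by omega : k ≤ -1)
        nlinarith
      · exact h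
      · have : (1 : ℝ) ≤ k := by exact_mod_cast h
        exact absurd (le_antisymm (hy2.trans hb) (by nlinarith)) h1
    subst hk
    simp only [Int.cast_zero, mul_zero, zero_sub] at hk1 hk2
    exact ⟨⟨hy1, hy2⟩, lt_of_le_of_ne (by linarith) (Ne.symm h2), by linarith⟩
  · rintro ⟨hy, hy1, hy2⟩
    refine ⟨hy, 0, ?_⟩
    have := lt_of_le_of_ne hy2 h3
    simp only [Int.cast_zero, mul_zero, zero_sub]
    exact ⟨by linarith, by linarith⟩

/-- Conjugation replaces the second increment by the one over (-d, -c], so the covariance is a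
second-order cumulant. With g₂ = 1 it is the Lebesgue measure of the set left by the Dirac comb. -/
lemma IsSpectralProcess.covariance_increment (hξ : IsSpectralProcess P ξ) {a b c d : ℝ}
    (ha : -Real.pi ≤ a) (hab : a ≤ b) (hb : b ≤ Real.pi)
    (hc : -Real.pi ≤ c) (hcd : c ≤ d) (hd : d ≤ Real.pi) :
    ∫ ω, (ξ b ω - ξ a ω) * (starRingEnd ℂ) (ξ d ω - ξ c ω) ∂P
      = (volume.real (Set.Ioc a b ∩ Set.Ioc c d) : ℂ) := by
  obtain ⟨g, M, -, -, h1, -, hcum⟩ := hξ.cumulant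
  have key := hcum 1 ![a, -d] ![b, -c] (by
    intro i
    fin_cases i
    · exact ⟨ha, hab, hb⟩
    · refine ⟨?_, ?_, ?_⟩ <;> simp <;> linarith)
  rw [jointCumulant_two] at key
  · have hconj := hξ.conj_increment c ⟨hc, hcd.trans hd⟩ d ⟨hc.trans hcd, hd⟩
    rw [integral_congr_ae (g := fun ω => (ξ b ω - ξ a ω) * (ξ (-c) ω - ξ (-d) ω))
      (by filter_upwards [hconj] with ω h; rw [h])]
    refine Eq.trans (by simp) (key.trans ?_)
    simp only [h1]
    rw [setIntegral_const]
    simp only [Complex.real_smul, mul_one]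
    congr 1
    have hset : {x : Fin 1 → ℝ | (∀ i : Fin 1, x i ∈ Set.Ioc ((![a, -d] : Fin 2 → ℝ) i.castSucc)
          ((![b, -c] : Fin 2 → ℝ) i.castSucc)) ∧ ∃ k : ℤ, 2 * Real.pi * (k : ℝ) - ∑ i, x i
              ∈ Set.Ioc ((![a, -d] : Fin 2 → ℝ) (Fin.last 1)) ((![b, -c] : Fin 2 → ℝ) (Fin.last 1))}
        = MeasurableEquiv.funUnique (Fin 1) ℝ ⁻¹' {y : ℝ | y ∈ Set.Ioc a b ∧
            ∃ k : ℤ, 2 * Real.pi * (k : ℝ) - y ∈ Set.Ioc (-d) (-c)} := by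
      ext x
      simp [MeasurableEquiv.funUnique]
    rw [hset, measureReal_def, measureReal_def,
      ← measure_congr (reflected_interval_ae_eq ha hb hc hd)]
    exact congrArg ENNReal.toReal
      ((volume_preserving_funUnique (Fin 1) ℝ).measure_preimage_equiv _)
  · intro i
    fin_cases i
    · simpa using hξ.integral_increment ha hab hb
    · simpa using hξ.integral_increment (by linarith) (neg_le_neg hcd) (by linarith)

end Increments

/-! ### Elementary integrals of step functions and their isometry -/

section StepFunctions

variable {Ω : Type*} [MeasurableSpace Ω] {P : Measure Ω} {ξ : ℝ → Ω → ℂ}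

/-- The frequency band `[-π, π]` with Lebesgue measure. -/
noncomputable abbrev bandMeasure : Measure ℝ :=
  volume.restrict (Set.Icc (-Real.pi) Real.pi)

lemma IsSpectralProcess.memLp_increment (hξ : IsSpectralProcess P ξ) {a b : ℝ}
    (h : -Real.pi ≤ a ∧ a ≤ b ∧ b ≤ Real.pi) : MemLp (fun ω => ξ b ω - ξ a ω) 2 P := by
  simpa using hξ.memLp a ⟨h.1, h.2.1.trans h.2.2⟩ b ⟨h.1.trans h.2.1, h.2.2⟩ 2

lemma StepFun.memLp_eval (S : StepFun) : MemLp S.eval 2 bandMeasure := by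
  unfold StepFun.eval
  refine memLp_finsetSum _ fun i _ => ?_
  exact (memLp_const (S.c i)).indicator measurableSet_Ioc

lemma StepFun.memLp_integral [IsProbabilityMeasure P] (hξ : IsSpectralProcess P ξ) (S : StepFun) :
    MemLp (S.integral ξ) 2 P := by
  unfold StepFun.integral
  exact memLp_finsetSum _ fun i _ => (hξ.memLp_increment (S.le i)).const_mul _

lemma StepFun.expect_integral [IsProbabilityMeasure P] (hξ : IsSpectralProcess P ξ)
    (S : StepFun) : ∫ ω, S.integral ξ ω ∂P = 0 := by
  unfold StepFun.integral
  rw [integral_finsetSum]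
  · refine Finset.sum_eq_zero fun i _ => ?_
    rw [integral_const_mul, hξ.integral_increment (S.le i).1 (S.le i).2.1 (S.le i).2.2, mul_zero]
  · exact fun i _ => ((hξ.memLp_increment (S.le i)).const_mul _).integrable one_le_two

lemma lpNorm_two_sq {α : Type*} [MeasurableSpace α] {ν : Measure α} {f : α → ℂ}
    (hf : MemLp f 2 ν) : lpNorm f 2 ν ^ 2 = ∫ x, ‖f x‖ ^ 2 ∂ν := by
  rw [lpNorm_eq_integral_norm_rpow_toReal (by simp) (by simp) hf.1]
  have h0 : 0 ≤ ∫ x, ‖f x‖ ^ 2 ∂ν := integral_nonneg fun x => by positivity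
  simp only [ENNReal.toReal_ofNat, Real.rpow_ofNat]
  rw [← Real.rpow_natCast, ← Real.rpow_mul h0]
  norm_num

lemma ofReal_integral_norm_sq {α : Type*} [MeasurableSpace α] {ν : Measure α} (f : α → ℂ) :
    ((∫ x, ‖f x‖ ^ 2 ∂ν : ℝ) : ℂ) = ∫ x, f x * (starRingEnd ℂ) (f x) ∂ν := by
  rw [← integral_complex_ofReal]
  congr 1 with x
  rw [Complex.mul_conj, Complex.normSq_eq_norm_sq]

lemma integrable_mul_conj {α : Type*} [MeasurableSpace α] {ν : Measure α} {f g : α → ℂ}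
    (hf : MemLp f 2 ν) (hg : MemLp g 2 ν) :
    Integrable (fun x => f x * (starRingEnd ℂ) (g x)) ν :=
  hf.integrable_mul (q := 2) hg.star

lemma integral_sum_mul_conj {α ι : Type*} [MeasurableSpace α] {ν : Measure α} (s : Finset ι)
    {f : ι → α → ℂ} (hf : ∀ i ∈ s, MemLp (f i) 2 ν) :
    ((∫ x, ‖∑ i ∈ s, f i x‖ ^ 2 ∂ν : ℝ) : ℂ)
      = ∑ i ∈ s, ∑ j ∈ s, ∫ x, f i x * (starRingEnd ℂ) (f j x) ∂ν := by
  rw [ofReal_integral_norm_sq]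
  simp only [map_sum, Finset.sum_mul_sum]
  rw [integral_finsetSum]
  · refine Finset.sum_congr rfl fun i hi => ?_
    rw [integral_finsetSum]
    exact fun j hj => integrable_mul_conj (hf i hi) (hf j hj)
  · exact fun i hi => integrable_finsetSum _ fun j hj => integrable_mul_conj (hf i hi) (hf j hj)

/-- Both squared norms expand into double sums over pairs of intervals, and the covariance of two
increments is the length of the overlap. The intervals of a step function may therefore overlap
freely. -/
lemma StepFun.isometry [IsProbabilityMeasure P] (hξ : IsSpectralProcess P ξ) (S : StepFun) :
    lpNorm (S.integral ξ) 2 P = lpNorm S.eval 2 bandMeasure := by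
  have hsq : lpNorm (S.integral ξ) 2 P ^ 2 = lpNorm S.eval 2 bandMeasure ^ 2 := by
    rw [lpNorm_two_sq (S.memLp_integral hξ), lpNorm_two_sq S.memLp_eval]
    apply Complex.ofReal_injective
    unfold StepFun.integral StepFun.eval
    rw [integral_sum_mul_conj _ fun i _ => (hξ.memLp_increment (S.le i)).const_mul _,
      integral_sum_mul_conj _ fun i _ => (memLp_const (S.c i)).indicator measurableSet_Ioc]
    refine Finset.sum_congr rfl fun i _ => Finset.sum_congr rfl fun j _ => ?_
    obtain ⟨hi1, hi2, hi3⟩ := S.le i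
    obtain ⟨hj1, hj2, hj3⟩ := S.le j
    have h1 : (fun ω => S.c i * (ξ (S.b i) ω - ξ (S.a i) ω) *
        (starRingEnd ℂ) (S.c j * (ξ (S.b j) ω - ξ (S.a j) ω)))
        = fun ω => (S.c i * (starRingEnd ℂ) (S.c j)) * ((ξ (S.b i) ω - ξ (S.a i) ω) *
        (starRingEnd ℂ) (ξ (S.b j) ω - ξ (S.a j) ω)) := by
      funext ω; rw [map_mul]; ring
    have h2 : (fun x => (Set.Ioc (S.a i) (S.b i)).indicator (fun _ => S.c i) x *
        (starRingEnd ℂ) ((Set.Ioc (S.a j) (S.b j)).indicator (fun _ => S.c j) x))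
        = (Set.Ioc (S.a i) (S.b i) ∩ Set.Ioc (S.a j) (S.b j)).indicator
          (fun _ => S.c i * (starRingEnd ℂ) (S.c j)) := by
      funext x
      by_cases h : x ∈ Set.Ioc (S.a i) (S.b i) <;> by_cases h' : x ∈ Set.Ioc (S.a j) (S.b j) <;>
        simp only [Set.indicator, Set.mem_inter_iff, h, h', if_true, if_false, and_true, and_false,
          map_zero, mul_zero, zero_mul]
    have h3 : Set.Ioc (S.a i) (S.b i) ∩ Set.Ioc (S.a j) (S.b j) ⊆ Set.Icc (-Real.pi) Real.pi :=
      fun x hx => ⟨hi1.trans hx.1.1.le, hx.1.2.trans hi3⟩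
    rw [h1, h2, integral_const_mul, hξ.covariance_increment hi1 hi2 hi3 hj1 hj2 hj3,
      integral_indicator (measurableSet_Ioc.inter measurableSet_Ioc), setIntegral_const,
      measureReal_def, measureReal_def, Measure.restrict_apply
      (measurableSet_Ioc.inter measurableSet_Ioc), Set.inter_eq_left.2 h3, Complex.real_smul, mul_comm]
  exact (pow_left_inj₀ lpNorm_nonneg lpNorm_nonneg two_ne_zero).1 hsq

/-- The zero step function. -/
def StepFun.zero : StepFun where
  k := 0
  c := fun _ => 0
  a := fun _ => 0
  b := fun _ => 0
  le := fun i => i.elim0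

/-- The sum of two step functions. -/
def StepFun.add (S R : StepFun) : StepFun where
  k := S.k + R.k
  c := Fin.addCases S.c R.c
  a := Fin.addCases S.a R.a
  b := Fin.addCases S.b R.b
  le := fun i => by
    induction i using Fin.addCases with
    | left i => simpa using S.le i
    | right i => simpa using R.le i

/-- A multiple of a step function. -/
noncomputable def StepFun.smul (z : ℂ) (S : StepFun) : StepFun where
  k := S.k
  c := fun i => z * S.c i
  a := S.a
  b := S.b
  le := S.le

lemma StepFun.eval_add (S R : StepFun) (x : ℝ) : (S.add R).eval x = S.eval x + R.eval x := by
  refine (Fin.sum_univ_add (a := S.k) (b := R.k) _).trans ?_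
  simp [StepFun.eval, StepFun.add]

lemma StepFun.integral_add {Ω' : Type*} {ξ : ℝ → Ω' → ℂ} (S R : StepFun) (ω : Ω') :
    (S.add R).integral ξ ω = S.integral ξ ω + R.integral ξ ω := by
  refine (Fin.sum_univ_add (a := S.k) (b := R.k) _).trans ?_
  simp [StepFun.integral, StepFun.add]

lemma StepFun.eval_smul (z : ℂ) (S : StepFun) (x : ℝ) : (S.smul z).eval x = z * S.eval x := by
  simp only [StepFun.eval, StepFun.smul, Finset.mul_sum]
  refine Finset.sum_congr rfl fun i _ => ?_
  by_cases h : x ∈ Set.Ioc (S.a i) (S.b i) <;> simp only [Set.indicator, h, if_true, if_false, mul_zero]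

lemma StepFun.integral_smul {Ω' : Type*} {ξ : ℝ → Ω' → ℂ} (z : ℂ) (S : StepFun) (ω : Ω') :
    (S.smul z).integral ξ ω = z * S.integral ξ ω := by
  unfold StepFun.integral
  rw [Finset.mul_sum]
  exact Finset.sum_congr rfl fun i _ => mul_assoc _ _ _

end StepFunctions

/-! ### The stochastic integral: isometry, mean and linearity -/

section SpectralIntegral

variable {Ω : Type*} [MeasurableSpace Ω] {P : Measure Ω} {ξ : ℝ → Ω → ℂ}

lemma tendsto_lpNorm_of_tendsto_eLpNorm_sub {α : Type*} [MeasurableSpace α] {ν : Measure α}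
    {f : ℕ → α → ℂ} {g : α → ℂ} (hf : ∀ N, MemLp (f N) 2 ν) (hg : MemLp g 2 ν)
    (h : Tendsto (fun N => eLpNorm (fun x => f N x - g x) 2 ν) atTop (𝓝 0)) :
    Tendsto (fun N => lpNorm (fun x => f N x - g x) 2 ν) atTop (𝓝 0) ∧
      Tendsto (fun N => lpNorm (f N) 2 ν) atTop (𝓝 (lpNorm g 2 ν)) := by
  have h1 : Tendsto (fun N => lpNorm (fun x => f N x - g x) 2 ν) atTop (𝓝 0) := by
    have := (ENNReal.tendsto_toReal ENNReal.zero_ne_top).comp h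
    simp only [ENNReal.toReal_zero] at this
    refine this.congr fun N => ?_
    exact toReal_eLpNorm ((hf N).sub hg).1
  refine ⟨h1, ?_⟩
  rw [tendsto_iff_dist_tendsto_zero]
  refine squeeze_zero (fun N => dist_nonneg) (fun N => ?_) h1
  rw [Real.dist_eq, abs_sub_le_iff]
  constructor
  · have := lpNorm_le_lpNorm_add_lpNorm_sub' (f := f N) hg one_le_two
    change lpNorm (f N) 2 ν - lpNorm g 2 ν ≤ lpNorm (f N - g) 2 ν
    linarith
  · have := lpNorm_le_lpNorm_add_lpNorm_sub (f := g) (hf N) one_le_two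
    change lpNorm g 2 ν - lpNorm (f N) 2 ν ≤ lpNorm (f N - g) 2 ν
    linarith

/-- The isometry for step functions survives both L² limits, and limits are unique. -/
lemma IsSpectralIntegral.lpNorm_eq [IsProbabilityMeasure P] (hξ : IsSpectralProcess P ξ) {h : ℝ → ℂ} {X : Ω → ℂ}
    (hX : IsSpectralIntegral P ξ h X) : lpNorm X 2 P = lpNorm h 2 bandMeasure := by
  obtain ⟨hh, hX2, S, hS, hI⟩ := hX
  have h1 := (tendsto_lpNorm_of_tendsto_eLpNorm_sub (fun N => (S N).memLp_eval) hh hS).2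
  have h2 := (tendsto_lpNorm_of_tendsto_eLpNorm_sub (fun N => (S N).memLp_integral hξ) hX2 hI).2
  simp only [StepFun.isometry hξ] at h2
  exact tendsto_nhds_unique h2 h1

/-- Elementary integrals have mean zero, and on a probability space the error in mean is at most the
L¹ error, hence at most the L² error. -/
lemma IsSpectralIntegral.expect_eq_zero [IsProbabilityMeasure P] (hξ : IsSpectralProcess P ξ) {h : ℝ → ℂ} {X : Ω → ℂ}
    (hX : IsSpectralIntegral P ξ h X) : ∫ ω, X ω ∂P = 0 := by
  obtain ⟨hh, hX2, S, hS, hI⟩ := hX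
  have h2 := (tendsto_lpNorm_of_tendsto_eLpNorm_sub (fun N => (S N).memLp_integral hξ) hX2 hI).1
  rw [← norm_le_zero_iff]
  refine ge_of_tendsto h2 (Eventually.of_forall fun N => ?_)
  have hm : MemLp (fun ω => (S N).integral ξ ω - X ω) 2 P := ((S N).memLp_integral hξ).sub hX2
  have : ∫ ω, X ω ∂P = -∫ ω, ((S N).integral ξ ω - X ω) ∂P := by
    rw [integral_sub (((S N).memLp_integral hξ).integrable one_le_two)
      (hX2.integrable one_le_two), (S N).expect_integral hξ]
    simp
  rw [this, norm_neg]
  refine (norm_integral_le_integral_norm _).trans ?_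
  rw [← lpNorm_one_eq_integral_norm hm.1, ← toReal_eLpNorm hm.1, ← toReal_eLpNorm hm.1]
  exact ENNReal.toReal_mono hm.2.ne (eLpNorm_le_eLpNorm_of_exponent_le one_le_two hm.1)

lemma IsSpectralIntegral.zero :
    IsSpectralIntegral P ξ (fun _ => 0) (fun _ => 0) := by
  refine ⟨MemLp.zero', MemLp.zero', fun _ => StepFun.zero, ?_, ?_⟩ <;>
    simp [StepFun.eval, StepFun.integral, StepFun.zero]

lemma IsSpectralIntegral.add [IsProbabilityMeasure P] (hξ : IsSpectralProcess P ξ) {h h' : ℝ → ℂ} {X X' : Ω → ℂ}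
    (hX : IsSpectralIntegral P ξ h X) (hX' : IsSpectralIntegral P ξ h' X') :
    IsSpectralIntegral P ξ (fun x => h x + h' x) (fun ω => X ω + X' ω) := by
  obtain ⟨hh, hX2, S, hS, hI⟩ := hX
  obtain ⟨hh', hX2', S', hS', hI'⟩ := hX'
  refine ⟨hh.add hh', hX2.add hX2', fun N => (S N).add (S' N), ?_, ?_⟩
  · refine tendsto_of_tendsto_of_tendsto_of_le_of_le tendsto_const_nhds
      (by simpa using hS.add hS') (fun _ => zero_le) fun N => ?_
    refine le_trans (le_of_eq ?_) (eLpNorm_add_le ((S N).memLp_eval.sub hh).1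
      ((S' N).memLp_eval.sub hh').1 one_le_two)
    congr 1 with x
    simp [StepFun.eval_add]
    ring
  · refine tendsto_of_tendsto_of_tendsto_of_le_of_le tendsto_const_nhds
      (by simpa using hI.add hI') (fun _ => zero_le) fun N => ?_
    refine le_trans (le_of_eq ?_) (eLpNorm_add_le (((S N).memLp_integral hξ).sub hX2).1
      (((S' N).memLp_integral hξ).sub hX2').1 one_le_two)
    congr 1 with x
    simp [StepFun.integral_add]
    ring

lemma IsSpectralIntegral.const_mul {h : ℝ → ℂ} {X : Ω → ℂ} (z : ℂ)
    (hX : IsSpectralIntegral P ξ h X) :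
    IsSpectralIntegral P ξ (fun x => z * h x) (fun ω => z * X ω) := by
  obtain ⟨hh, hX2, S, hS, hI⟩ := hX
  refine ⟨hh.const_mul z, hX2.const_mul z, fun N => (S N).smul z, ?_, ?_⟩
  · have := ENNReal.Tendsto.const_mul (a := ‖z‖ₑ) hS (Or.inr enorm_ne_top)
    rw [mul_zero] at this
    refine this.congr fun N => ?_
    rw [← eLpNorm_const_smul]
    congr 1 with x
    simp [StepFun.eval_smul, mul_sub]
  · have := ENNReal.Tendsto.const_mul (a := ‖z‖ₑ) hI (Or.inr enorm_ne_top)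
    rw [mul_zero] at this
    refine this.congr fun N => ?_
    rw [← eLpNorm_const_smul]
    congr 1 with x
    simp [StepFun.integral_smul, mul_sub]

/-- This makes the Fourier transform of the whole centred window a single spectral integral, so its
variance is one L² norm and no autocovariances are needed. -/
lemma IsSpectralIntegral.sum [IsProbabilityMeasure P] (hξ : IsSpectralProcess P ξ) {ι : Type*} (s : Finset ι)
    {h : ι → ℝ → ℂ} {X : ι → Ω → ℂ} (hX : ∀ i ∈ s, IsSpectralIntegral P ξ (h i) (X i)) :
    IsSpectralIntegral P ξ (fun x => ∑ i ∈ s, h i x) (fun ω => ∑ i ∈ s, X i ω) := by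
  classical
  induction s using Finset.induction_on with
  | empty => simpa using IsSpectralIntegral.zero
  | insert i s hi ih =>
    simp only [Finset.sum_insert hi]
    exact (hX i (Finset.mem_insert_self i s)).add hξ
      (ih fun k hk => hX k (Finset.mem_insert_of_mem hk))

/-- The cross term is linear in `X`, whose mean is zero; the isometry evaluates the quadratic term.
-/
lemma IsSpectralIntegral.expect_norm_sq_const_add [IsProbabilityMeasure P] (hξ : IsSpectralProcess P ξ) {h : ℝ → ℂ}
    {X : Ω → ℂ} (hX : IsSpectralIntegral P ξ h X) (z : ℂ) :
    ∫ ω, ‖z + X ω‖ ^ 2 ∂P = ‖z‖ ^ 2 + lpNorm h 2 bandMeasure ^ 2 := by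
  have hX2 := hX.2.1
  rw [← hX.lpNorm_eq hξ, lpNorm_two_sq hX2]
  have h1 : Integrable (fun ω => ‖X ω‖ ^ 2) P := hX2.integrable_norm_pow two_ne_zero
  have h2 : Integrable (fun ω => (starRingEnd ℂ) z * X ω) P :=
    (hX2.integrable one_le_two).const_mul _
  have h3 : ∫ ω, ((starRingEnd ℂ) z * X ω).re ∂P = 0 := by
    have := integral_re h2
    simp only [RCLike.re_eq_complex_re] at this
    rw [this, integral_const_mul, hX.expect_eq_zero hξ]
    simp
  have h4 : ∀ ω, ‖z + X ω‖ ^ 2 = (‖z‖ ^ 2 + 2 * ((starRingEnd ℂ) z * X ω).re) + ‖X ω‖ ^ 2 := by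
    intro ω
    rw [← Complex.normSq_eq_norm_sq, ← Complex.normSq_eq_norm_sq, ← Complex.normSq_eq_norm_sq,
      Complex.normSq_add, ← Complex.conj_re (z * _)]
    simp
    ring
  have h5 : Integrable (fun ω => 2 * ((starRingEnd ℂ) z * X ω).re) P := h2.re.const_mul 2
  have h6 : Integrable (fun ω => ‖z‖ ^ 2 + 2 * ((starRingEnd ℂ) z * X ω).re) P :=
    (integrable_const _).add h5
  simp only [h4]
  rw [integral_add h6 h1, integral_add (integrable_const _) h5,
    integral_const_mul, h3]
  simp

end SpectralIntegral

/-! ### Orthogonality of waves and slowly varying amplitudes -/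

section Waves

/-- The wave `y ↦ exp(-i x s) exp(i y (a + s))`, of modulus one. -/
noncomputable def wave (a : ℤ) (x : ℝ) (s : ℕ) (y : ℝ) : ℂ :=
  Complex.exp (-Complex.I * (x : ℂ) * (s : ℂ)) *
    Complex.exp (Complex.I * (y : ℂ) * ((a + (s : ℤ) : ℤ) : ℂ))

lemma norm_cexp_neg_I_mul_natCast (x : ℝ) (s : ℕ) :
    ‖Complex.exp (-Complex.I * (x : ℂ) * (s : ℂ))‖ = 1 := by
  rw [show -Complex.I * (x : ℂ) * (s : ℂ) = ((-x * s : ℝ) : ℂ) * Complex.I by push_cast; ring,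
    Complex.norm_exp_ofReal_mul_I]

lemma norm_wave (a : ℤ) (x : ℝ) (s : ℕ) (y : ℝ) : ‖wave a x s y‖ = 1 := by
  rw [wave, norm_mul, norm_cexp_neg_I_mul_natCast, show Complex.I * (y : ℂ) * ((a + (s : ℤ) : ℤ) : ℂ)
    = ((y * (a + (s : ℤ) : ℤ) : ℝ) : ℂ) * Complex.I by push_cast; ring,
    Complex.norm_exp_ofReal_mul_I, mul_one]

lemma continuous_wave (a : ℤ) (x : ℝ) (s : ℕ) : Continuous (wave a x s) := by
  unfold wave
  fun_prop

lemma memLp_wave (a : ℤ) (x : ℝ) (s : ℕ) : MemLp (wave a x s) 2 bandMeasure :=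
  MemLp.of_bound (continuous_wave a x s).aestronglyMeasurable 1
    (Eventually.of_forall fun y => (norm_wave a x s y).le)

lemma integral_band_cexp {k : ℤ} (hk : k ≠ 0) :
    ∫ y, Complex.exp (Complex.I * (k : ℂ) * (y : ℂ)) ∂bandMeasure = 0 := by
  rw [bandMeasure, integral_Icc_eq_integral_Ioc,
    ← intervalIntegral.integral_of_le (by linarith [Real.pi_pos]),
    integral_exp_mul_complex (mul_ne_zero Complex.I_ne_zero (by exact_mod_cast hk)),
    (Complex.exp_eq_exp_iff_exists_int).2 ⟨k, ?_⟩, sub_self, zero_div]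
  push_cast
  ring

lemma integral_wave_mul_conj (a : ℤ) (x : ℝ) (s r : ℕ) :
    ∫ y, wave a x s y * (starRingEnd ℂ) (wave a x r y) ∂bandMeasure
      = if s = r then ((2 * Real.pi : ℝ) : ℂ) else 0 := by
  split_ifs with h
  · subst h
    have : ∀ y, wave a x s y * (starRingEnd ℂ) (wave a x s y) = 1 := fun y => by
      rw [Complex.mul_conj, Complex.normSq_eq_norm_sq, norm_wave]
      simp
    simp only [this]
    rw [integral_const, measureReal_restrict_apply_univ, Real.volume_real_Icc_of_le
      (by linarith [Real.pi_pos])]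
    simp
    ring
  · have : ∀ y : ℝ, wave a x s y * (starRingEnd ℂ) (wave a x r y)
        = Complex.exp (-Complex.I * (x : ℂ) * ((s : ℂ) - r)) *
          Complex.exp (Complex.I * (((s : ℤ) - (r : ℤ) : ℤ) : ℂ) * (y : ℂ)) := fun y => by
      simp only [wave, ← Complex.exp_conj, ← Complex.exp_add]
      congr 1
      simp
      ring
    simp only [this]
    rw [integral_const_mul, integral_band_cexp (by omega), mul_zero]

/-- Distinct waves are orthogonal and each has squared norm 2π. This factor is the surplus over f
that is used in the comparison of E I with f. -/
lemma lpNorm_sum_wave (a : ℤ) (x : ℝ) (S : Finset ℕ) :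
    lpNorm (fun y => ∑ s ∈ S, wave a x s y) 2 bandMeasure
      = Real.sqrt (2 * Real.pi) * Real.sqrt S.card := by
  have hsq : lpNorm (fun y => ∑ s ∈ S, wave a x s y) 2 bandMeasure ^ 2
      = 2 * Real.pi * S.card := by
    rw [lpNorm_two_sq (memLp_finsetSum S fun s _ => memLp_wave a x s)]
    apply Complex.ofReal_injective
    rw [integral_sum_mul_conj S fun s _ => memLp_wave a x s]
    simp only [integral_wave_mul_conj, Finset.sum_ite_eq, Finset.sum_ite_mem, Finset.inter_self,
      Finset.sum_const]
    simp
    ring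
  rw [← Real.sqrt_mul (by positivity), ← hsq, Real.sqrt_sq lpNorm_nonneg]

lemma MemLp.band_bounded_mul {f g : ℝ → ℂ} {c : ℝ} (hf : AEStronglyMeasurable f bandMeasure)
    (hb : ∀ y ∈ Set.Icc (-Real.pi) Real.pi, ‖f y‖ ≤ c) (hg : MemLp g 2 bandMeasure) :
    MemLp (fun y => f y * g y) 2 bandMeasure := by
  refine MemLp.of_le_mul (c := c) hg (hf.mul hg.1) ?_
  filter_upwards [ae_restrict_mem measurableSet_Icc] with y hy
  rw [norm_mul]
  exact mul_le_mul_of_nonneg_right (hb y hy) (norm_nonneg _)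

lemma lpNorm_band_bounded_mul_le {f g : ℝ → ℂ} {c : ℝ}
    (hf : AEStronglyMeasurable f bandMeasure)
    (hb : ∀ y ∈ Set.Icc (-Real.pi) Real.pi, ‖f y‖ ≤ c) (hg : MemLp g 2 bandMeasure) :
    lpNorm (fun y => f y * g y) 2 bandMeasure ≤ c * lpNorm g 2 bandMeasure := by
  have hc : 0 ≤ c := (norm_nonneg _).trans (hb 0 ⟨by linarith [Real.pi_pos], Real.pi_pos.le⟩)
  have h := eLpNorm_le_mul_eLpNorm_of_ae_le_mul (f := fun y => f y * g y) (g := g) (c := c)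
    (μ := bandMeasure) (by
      filter_upwards [ae_restrict_mem measurableSet_Icc] with y hy
      rw [norm_mul]
      exact mul_le_mul_of_nonneg_right (hb y hy) (norm_nonneg _)) 2
  have hfg : AEStronglyMeasurable (fun y => f y * g y) bandMeasure := hf.mul hg.1
  rw [← toReal_eLpNorm hfg, ← toReal_eLpNorm hg.1]
  have := ENNReal.toReal_mono (ENNReal.mul_ne_top ENNReal.ofReal_ne_top hg.2.ne) h
  rwa [ENNReal.toReal_mul, ENNReal.toReal_ofReal hc] at this

/-- Summation by parts: slowly varying amplitudes do not destroy the orthogonality of waves. -/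
lemma lpNorm_sum_amplitude_mul_wave_le (a : ℤ) (x : ℝ) (p m : ℕ) {F : ℕ → ℝ → ℂ} {α β : ℝ}
    (hα : 0 ≤ α) (hβ : 0 ≤ β)
    (hF : ∀ s < m, AEStronglyMeasurable (F s) bandMeasure)
    (hFα : ∀ s < m, ∀ y ∈ Set.Icc (-Real.pi) Real.pi, ‖F s y‖ ≤ α)
    (hFβ : ∀ s, s + 1 < m → ∀ y ∈ Set.Icc (-Real.pi) Real.pi, ‖F (s + 1) y - F s y‖ ≤ β) :
    lpNorm (fun y => ∑ s ∈ Finset.range m, F s y * wave a x (p + s) y) 2 bandMeasure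
      ≤ Real.sqrt (2 * Real.pi) * ((α + m * β) * Real.sqrt m) := by
  rcases Nat.eq_zero_or_pos m with rfl | hm
  · simp
  have hD : ∀ k : ℕ, MemLp (fun y => ∑ i ∈ Finset.range k, wave a x (p + i) y) 2 bandMeasure :=
    fun k => memLp_finsetSum _ fun i _ => memLp_wave a x (p + i)
  -- Abel summation involves only partial sums of waves, and one norm bound serves them all.
  have hDn : ∀ k : ℕ, k ≤ m → lpNorm (fun y => ∑ i ∈ Finset.range k, wave a x (p + i) y) 2
      bandMeasure ≤ Real.sqrt (2 * Real.pi) * Real.sqrt m := by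
    intro k hk
    have := lpNorm_sum_wave a x ((Finset.range k).map (addLeftEmbedding p))
    simp only [Finset.sum_map, addLeftEmbedding_apply, Finset.card_map, Finset.card_range] at this
    rw [this]
    gcongr
  have hfun : (fun y => ∑ s ∈ Finset.range m, F s y * wave a x (p + s) y)
      = (fun y => F (m - 1) y * ∑ i ∈ Finset.range m, wave a x (p + i) y) -
        ∑ s ∈ Finset.range (m - 1), fun y =>
          (F (s + 1) y - F s y) * ∑ i ∈ Finset.range (s + 1), wave a x (p + i) y := by
    funext y
    have := Finset.sum_range_by_parts (fun s => F s y) (fun s => wave a x (p + s) y) m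
    simpa [Finset.sum_apply] using this
  have hsm : ∀ s ∈ Finset.range (m - 1), AEStronglyMeasurable (fun y => F (s + 1) y - F s y)
      bandMeasure := fun s hs => by
    rw [Finset.mem_range] at hs
    exact (hF (s + 1) (by omega)).sub (hF s (by omega))
  have hsb : ∀ s ∈ Finset.range (m - 1), ∀ y ∈ Set.Icc (-Real.pi) Real.pi,
      ‖F (s + 1) y - F s y‖ ≤ β := fun s hs => by
    rw [Finset.mem_range] at hs
    exact hFβ s (by omega)
  rw [hfun]
  refine (lpNorm_sub_le (MemLp.band_bounded_mul (hF _ (by omega)) (hFα _ (by omega)) (hD m))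
    one_le_two).trans ?_
  have h1 := lpNorm_band_bounded_mul_le (hF (m - 1) (by omega)) (hFα (m - 1) (by omega)) (hD m)
  have h2 : lpNorm (∑ s ∈ Finset.range (m - 1), fun y =>
          (F (s + 1) y - F s y) * ∑ i ∈ Finset.range (s + 1), wave a x (p + i) y) 2 bandMeasure
      ≤ m * (β * (Real.sqrt (2 * Real.pi) * Real.sqrt m)) := by
    refine (lpNorm_sum_le (fun s hs => MemLp.band_bounded_mul (hsm s hs) (hsb s hs) (hD _))
      one_le_two).trans ?_
    have : ∀ s ∈ Finset.range (m - 1), lpNorm (fun y => (F (s + 1) y - F s y) *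
        ∑ i ∈ Finset.range (s + 1), wave a x (p + i) y) 2 bandMeasure
        ≤ β * (Real.sqrt (2 * Real.pi) * Real.sqrt m) := fun s hs => by
      refine (lpNorm_band_bounded_mul_le (hsm s hs) (hsb s hs) (hD _)).trans ?_
      rw [Finset.mem_range] at hs
      exact mul_le_mul_of_nonneg_left (hDn _ (by omega)) hβ
    refine (Finset.sum_le_card_nsmul _ _ _ this).trans ?_
    rw [nsmul_eq_mul, Finset.card_range]
    gcongr
    exact Nat.sub_le m 1
  calc _ ≤ α * (Real.sqrt (2 * Real.pi) * Real.sqrt m)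
        + m * (β * (Real.sqrt (2 * Real.pi) * Real.sqrt m)) :=
        add_le_add (h1.trans (mul_le_mul_of_nonneg_left (hDn m le_rfl) hα)) h2
    _ = _ := by ring

end Waves

/-! ### Exact formula for the mean local periodogram -/

section MeanPeriodogram

variable {Ω : Type*} [MeasurableSpace Ω] {P : Measure Ω} {V : ℕ → ℤ → Ω → ℝ} {m₀ : ℕ}
  {lam : Fin (m₀ + 2) → ℝ} {A0 : ℕ → ℤ → ℝ → ℂ} {A : ℝ → ℝ → ℂ} {mu : ℝ → ℝ}

/-- The discrete Fourier transform of the trend over the window. -/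
noncomputable def trendTransform (mu : ℝ → ℝ) (T n : ℕ) (v x : ℝ) : ℂ :=
  ∑ s ∈ Finset.range n, (mu (((windowStart T n v + (s : ℤ) : ℤ) : ℝ) / (T : ℝ)) : ℂ) *
    Complex.exp (-Complex.I * (x : ℂ) * (s : ℂ))

/-- The spectral kernel of the discrete Fourier transform of the centered window. -/
noncomputable def windowKernel (A0 : ℕ → ℤ → ℝ → ℂ) (T n : ℕ) (v x : ℝ) (y : ℝ) : ℂ :=
  ∑ s ∈ Finset.range n, A0 T (windowStart T n v + (s : ℤ)) y * wave (windowStart T n v) x s y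

lemma windowStart_add_mem {T n : ℕ} {v : ℝ} (hn : Even n)
    (hw : window T n v ⊆ Set.Icc (1 : ℤ) (T : ℤ)) {s : ℕ} (hs : s < n) :
    1 ≤ windowStart T n v + (s : ℤ) ∧ windowStart T n v + (s : ℤ) ≤ T := by
  have : windowStart T n v + (s : ℤ) ∈ window T n v := by
    obtain ⟨k, rfl⟩ := hn
    simp only [window, windowStart, Set.mem_Icc]
    omega
  exact hw this

/-- Square integrability is part of the representation, where the transfer function carries a phase
of modulus one; multiplying by the inverse phase removes it. -/
lemma IsSLS.memLp_transfer (hV : IsSLS P V lam A0 A mu) {T : ℕ} {t : ℤ} (h1 : 1 ≤ t)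
    (h2 : t ≤ T) : MemLp (A0 T t) 2 bandMeasure := by
  obtain ⟨ξ, -, hrep⟩ := hV.representation
  have h := (hrep T t h1 h2).1
  have := MemLp.band_bounded_mul (f := fun y : ℝ => Complex.exp (-(Complex.I * (y : ℂ) * (t : ℂ))))
    (c := 1) (by fun_prop : Continuous _).aestronglyMeasurable (fun y _ => by
      rw [show -(Complex.I * (y : ℂ) * (t : ℂ)) = ((-(y * t) : ℝ) : ℂ) * Complex.I by
        push_cast; ring, Complex.norm_exp_ofReal_mul_I]) h
  refine this.ae_eq (Eventually.of_forall fun y => ?_)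
  rw [← mul_assoc, ← Complex.exp_add, neg_add_cancel, Complex.exp_zero, one_mul]

lemma IsSLS.meanLocalPeriodogram_eq [IsProbabilityMeasure P] (hV : IsSLS P V lam A0 A mu)
    {T n : ℕ} {v : ℝ} (hn : Even n) (hw : window T n v ⊆ Set.Icc (1 : ℤ) (T : ℤ)) (x : ℝ) :
    meanLocalPeriodogram P V T n v x = (1 / n) * (‖trendTransform mu T n v x‖ ^ 2 +
      lpNorm (windowKernel A0 T n v x) 2 bandMeasure ^ 2) := by
  obtain ⟨ξ, hξ, hrep⟩ := hV.representation
  have hI := IsSpectralIntegral.sum hξ (Finset.range n) (fun s hs =>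
    (hrep T (windowStart T n v + (s : ℤ))
      (windowStart_add_mem hn hw (Finset.mem_range.1 hs)).1
      (windowStart_add_mem hn hw (Finset.mem_range.1 hs)).2).const_mul
      (Complex.exp (-Complex.I * (x : ℂ) * (s : ℂ))))
  have hk : (fun y : ℝ => ∑ s ∈ Finset.range n, Complex.exp (-Complex.I * (x : ℂ) * (s : ℂ)) *
      (Complex.exp (Complex.I * (y : ℂ) * ((windowStart T n v + (s : ℤ) : ℤ) : ℂ)) *
        A0 T (windowStart T n v + (s : ℤ)) y)) = windowKernel A0 T n v x := by
    funext y
    refine Finset.sum_congr rfl fun s _ => ?_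
    rw [wave]
    ring
  rw [hk] at hI
  rw [← hI.expect_norm_sq_const_add hξ, ← integral_const_mul]
  unfold meanLocalPeriodogram localPeriodogram
  congr 1 with ω
  rw [norm_mul, mul_pow]
  congr 1
  · simp
  · rw [trendTransform, ← Finset.sum_add_distrib]
    congr 2
    refine Finset.sum_congr rfl fun s _ => ?_
    push_cast
    ring

end MeanPeriodogram

/-! ### Regimes and uniform bounds on the transfer function -/

section Regimes

variable {m₀ : ℕ} {lam : Fin (m₀ + 2) → ℝ} {A : ℝ → ℝ → ℂ}

lemma IsBreakFractions.regime_subset (h : IsBreakFractions lam) (j : Fin (m₀ + 1)) :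
    regime lam j ⊆ Set.Ioc 0 1 := by
  intro v hv
  refine ⟨lt_of_le_of_lt ?_ hv.1, hv.2.trans ?_⟩
  · rw [← h.zero]
    exact h.strictMono.monotone (Fin.zero_le _)
  · rw [← h.one]
    exact h.strictMono.monotone (Fin.le_last _)

lemma IsBreakFractions.exists_regime (h : IsBreakFractions lam) {v : ℝ}
    (hv : v ∈ Set.Ioc (0 : ℝ) 1) : ∃ j, v ∈ regime lam j := by
  obtain ⟨i, hi, hmax⟩ := (Finset.univ.filter fun i => lam i < v).exists_max_image id
    ⟨0, by simpa [h.zero] using hv.1⟩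
  simp only [Finset.mem_filter, Finset.mem_univ, true_and, id] at hi hmax
  have hne : i ≠ Fin.last (m₀ + 1) := by
    rintro rfl
    rw [h.one] at hi
    exact absurd hv.2 (not_le.2 hi)
  obtain ⟨j, rfl⟩ := Fin.exists_castSucc_eq.2 hne
  refine ⟨j, hi, ?_⟩
  by_contra hcon
  exact absurd (hmax j.succ (not_le.1 hcon)) (not_le.2 (Fin.castSucc_lt_succ))

/-- The mean value inequality on a half-open regime needs only derivatives within it, and at the
right end this is the left derivative. Nothing is claimed across a break. -/
lemma SmoothTransfer.lipschitz_time (hA : SmoothTransfer lam A) (h : IsBreakFractions lam) :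
    ∃ M : ℝ, 0 ≤ M ∧ ∀ j, ∀ v ∈ regime lam j, ∀ w ∈ regime lam j, ∀ x,
      ‖A v x - A w x‖ ≤ M * |v - w| := by
  obtain ⟨⟨A1, A2, h1, h2, ⟨M, hM⟩, -⟩, -⟩ := hA
  refine ⟨M, (norm_nonneg _).trans (hM 1 (by norm_num) 0).1, fun j v hv w hw x => ?_⟩
  rw [← Real.norm_eq_abs]
  refine Convex.norm_image_sub_le_of_norm_hasDerivWithin_le (s := regime lam j)
    (f := fun v => A v x) (f' := fun v => A1 v x) (fun z hz => ?_)
    (fun z hz => (hM z (h.regime_subset j hz) x).1) (convex_Ioc _ _) hw hv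
  rcases eq_or_lt_of_le hz.2 with heq | hlt
  · rw [heq]
    exact ((h2 j x).1).mono fun y hy => hy.2
  · exact ((h1 j z ⟨hz.1, hlt⟩ x).1).hasDerivWithinAt

lemma SmoothTransfer.lipschitz_freq (hA : SmoothTransfer lam A) :
    ∃ L : ℝ, 0 ≤ L ∧ ∀ v ∈ Set.Ioc (0 : ℝ) 1, ∀ x y, ‖A v x - A v y‖ ≤ L * |x - y| := by
  obtain ⟨-, L, hL⟩ := hA
  exact ⟨max L 0, le_max_right _ _, fun v hv x y => (hL v hv x y).trans
    (mul_le_mul_of_nonneg_right (le_max_left _ _) (abs_nonneg _))⟩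

lemma SmoothTransfer.continuous_freq (hA : SmoothTransfer lam A) {v : ℝ}
    (hv : v ∈ Set.Ioc (0 : ℝ) 1) : Continuous (A v) := by
  obtain ⟨L, hL0, hL⟩ := hA.lipschitz_freq
  refine (LipschitzWith.of_dist_le_mul (K := L.toNNReal) fun x y => ?_).continuous
  rw [dist_eq_norm, Real.dist_eq, Real.coe_toNNReal _ hL0]
  exact hL v hv x y

/-- The value is compared with that at the right end of its regime and at frequency zero: the move
costs at most `M` in time and `L * π` in frequency. The sum over the finitely many regimes dominates
each anchor value. -/
lemma SmoothTransfer.bounded (hA : SmoothTransfer lam A) (h : IsBreakFractions lam) :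
    ∃ C : ℝ, 0 ≤ C ∧ ∀ v ∈ Set.Ioc (0 : ℝ) 1, ∀ x ∈ Set.Icc (-Real.pi) Real.pi, ‖A v x‖ ≤ C := by
  obtain ⟨M, hM0, hM⟩ := hA.lipschitz_time h
  obtain ⟨L, hL0, hL⟩ := hA.lipschitz_freq
  have hpi := Real.pi_pos
  refine ⟨M + L * Real.pi + ∑ j : Fin (m₀ + 1), ‖A (lam j.succ) 0‖, by positivity,
    fun v hv x hx => ?_⟩
  obtain ⟨j, hj⟩ := h.exists_regime hv
  have hr : lam j.succ ∈ regime lam j := ⟨h.strictMono Fin.castSucc_lt_succ, le_rfl⟩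
  have h01 := h.regime_subset j hr
  have e1 : ‖A v x - A (lam j.succ) x‖ ≤ M := by
    refine (hM j v hj _ hr x).trans (mul_le_of_le_one_right hM0 ?_)
    rw [abs_le]
    constructor <;> linarith [hv.1, hv.2, h01.1, h01.2]
  have e2 : ‖A (lam j.succ) x - A (lam j.succ) 0‖ ≤ L * Real.pi := by
    refine (hL _ h01 x 0).trans (mul_le_mul_of_nonneg_left ?_ hL0)
    rw [sub_zero, abs_le]
    exact ⟨hx.1, hx.2⟩
  have e3 : ‖A (lam j.succ) 0‖ ≤ ∑ j : Fin (m₀ + 1), ‖A (lam j.succ) 0‖ :=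
    Finset.single_le_sum (f := fun j : Fin (m₀ + 1) => ‖A (lam j.succ) 0‖)
      (fun _ _ => norm_nonneg _) (Finset.mem_univ j)
  calc ‖A v x‖ = ‖(A v x - A (lam j.succ) x) + (A (lam j.succ) x - A (lam j.succ) 0)
        + A (lam j.succ) 0‖ := by congr 1; ring
    _ ≤ _ := (norm_add₃_le).trans (by linarith)

/-- Dates between which there is no break belong to one regime. -/
lemma IsBreakFractions.exists_common_regime (h : IsBreakFractions lam) {T : ℕ} {p q : ℤ}
    (hp : 1 ≤ p) (hpq : p ≤ q) (hq : q ≤ T)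
    (hno : ∀ i : Fin m₀, ¬ (p ≤ breakDate lam T i ∧ breakDate lam T i < q)) :
    ∃ j, ∀ t : ℤ, p ≤ t → t ≤ q → (t : ℝ) / T ∈ regime lam j := by
  have hT : (0 : ℝ) < T := by exact_mod_cast (by omega : 0 < (T : ℤ))
  have hpT : (p : ℝ) / T ∈ Set.Ioc (0 : ℝ) 1 :=
    ⟨div_pos (by exact_mod_cast (by omega : 0 < p)) hT,
      (div_le_one hT).2 (by exact_mod_cast hpq.trans hq)⟩
  obtain ⟨j, hj⟩ := h.exists_regime hpT
  refine ⟨j, fun t hpt htq => ⟨hj.1.trans_le ?_, ?_⟩⟩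
  · exact div_le_div_of_nonneg_right (by exact_mod_cast hpt) hT.le
  · rw [div_le_iff₀ hT]
    -- The right end of a regime is a break, except for the last regime, where it is 1 and `q ≤ T`
    -- suffices.
    rcases Fin.eq_castSucc_or_eq_last j with ⟨i, rfl⟩ | rfl
    · have hi : p ≤ breakDate lam T i := by
        rw [breakDate, Int.le_floor, mul_comm, ← div_le_iff₀ hT]
        exact hj.2
      have hqi : q ≤ breakDate lam T i := by
        by_contra hcon
        exact hno i ⟨hi, not_le.1 hcon⟩
      have := Int.le_floor.1 (htq.trans hqi)
      rw [mul_comm]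
      exact this
    · rw [Fin.succ_last, h.one, one_mul]
      exact_mod_cast htq.trans hq

/-- A regime is an interval and `v` lies between the two rescaled dates. -/
lemma mem_regime_of_floor_mem {T : ℕ} {v : ℝ} {j : Fin (m₀ + 1)} (hT : 0 < T)
    (h0 : ((⌊(T : ℝ) * v⌋ : ℤ) : ℝ) / T ∈ regime lam j)
    (h1 : ((⌊(T : ℝ) * v⌋ + 1 : ℤ) : ℝ) / T ∈ regime lam j) : v ∈ regime lam j := by
  have hT' : (0 : ℝ) < T := by exact_mod_cast hT
  refine ⟨h0.1.trans_le ?_, le_trans ?_ h1.2⟩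
  · rw [div_le_iff₀ hT', mul_comm]
    exact Int.floor_le _
  · rw [le_div_iff₀ hT', mul_comm]
    push_cast
    exact (Int.lt_floor_add_one _).le

end Regimes

/-! ### Decay of the Dirichlet kernel -/

section Dirichlet

/-- Jordan's inequality up to π/2; beyond, reflection at π/2 gives |sin t| ≥ 1/2, and 3π/4 < 5/2. -/
lemma abs_le_five_mul_abs_sin {t : ℝ} (h : |t| ≤ 3 * Real.pi / 4) :
    |t| ≤ 5 * |Real.sin t| := by
  have hpi := Real.pi_pos
  have hpi3 := Real.pi_lt_d2
  rcases le_total |t| (Real.pi / 2) with h1 | h1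
  · have := Real.mul_abs_le_abs_sin h1
    rw [div_mul_eq_mul_div, div_le_iff₀ hpi] at this
    nlinarith [abs_nonneg (Real.sin t)]
  · have h2 : abs (Real.pi - |t|) = Real.pi - |t| := abs_of_nonneg (by linarith)
    have := Real.mul_abs_le_abs_sin (x := Real.pi - |t|) (by rw [h2]; linarith)
    rw [Real.sin_pi_sub, h2, div_mul_eq_mul_div, div_le_iff₀ hpi] at this
    have hs : abs (Real.sin |t|) = |Real.sin t| := by
      rcases abs_choice t with h | h <;> rw [h] <;> simp
    rw [hs] at this
    have h3 : Real.pi * (1 / 2) ≤ Real.pi * |Real.sin t| := by linarith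
    have := le_of_mul_le_mul_left h3 hpi
    linarith

/-- Geometric sum: (z - 1) ∑ z^s = z^n - 1 has modulus at most 2. The restriction |x| ≤ π/2 keeps |y
- x|/2 below 3π/4, away from the next peak of the periodic kernel at |y - x| = 2π. -/
lemma abs_sub_mul_norm_sum_wave_le (a : ℤ) {x y : ℝ} (n : ℕ) (hx : |x| ≤ Real.pi / 2)
    (hy : y ∈ Set.Icc (-Real.pi) Real.pi) :
    |y - x| * ‖∑ s ∈ Finset.range n, wave a x s y‖ ≤ 10 := by
  set z : ℂ := Complex.exp (Complex.I * ((y - x : ℝ) : ℂ)) with hz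
  have hz1 : ‖z‖ = 1 := by rw [hz, mul_comm, Complex.norm_exp_ofReal_mul_I]
  have hw : ∀ s, wave a x s y = Complex.exp (Complex.I * ((y * a : ℝ) : ℂ)) * z ^ s := fun s => by
    rw [hz, wave, ← Complex.exp_nat_mul, ← Complex.exp_add, ← Complex.exp_add]
    congr 1
    push_cast
    ring
  simp only [hw, ← Finset.mul_sum]
  rw [norm_mul, mul_comm Complex.I (((y * a : ℝ) : ℂ)), Complex.norm_exp_ofReal_mul_I, one_mul]
  have h1 : |y - x| ≤ 5 * ‖z - 1‖ := by
    rw [hz, Complex.norm_exp_I_mul_ofReal_sub_one, norm_mul, Real.norm_eq_abs, Real.norm_eq_abs]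
    have := abs_le_five_mul_abs_sin (t := (y - x) / 2) (by
      rw [abs_le] at hx ⊢
      constructor <;> linarith [hy.1, hy.2, hx.1, hx.2])
    rw [abs_div] at this
    norm_num at this ⊢
    linarith
  calc _ ≤ 5 * ‖z - 1‖ * ‖∑ s ∈ Finset.range n, z ^ s‖ := by gcongr
    _ = 5 * ‖z ^ n - 1‖ := by rw [mul_assoc, ← norm_mul, mul_comm (z - 1), geom_sum_mul]
    _ ≤ 5 * (1 + 1) := by
        gcongr
        refine (norm_sub_le _ _).trans ?_
        simp [hz1]
    _ = 10 := by norm_num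

lemma lpNorm_band_le_of_bound {f : ℝ → ℂ} {c : ℝ} (hf : AEStronglyMeasurable f bandMeasure)
    (hb : ∀ y ∈ Set.Icc (-Real.pi) Real.pi, ‖f y‖ ≤ c) :
    lpNorm f 2 bandMeasure ≤ Real.sqrt (2 * Real.pi) * c := by
  have h := lpNorm_band_bounded_mul_le hf hb (memLp_const (1 : ℂ))
  have h1 := lpNorm_sum_wave 0 0 {0}
  have h2 : ∀ y, wave 0 0 0 y = 1 := fun y => by simp [wave]
  simp only [Finset.sum_singleton, Finset.card_singleton, h2, Nat.cast_one, Real.sqrt_one,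
    mul_one] at h1
  simp only [mul_one] at h
  rw [h1, mul_comm] at h
  exact h

end Dirichlet

/-! ### Lower bound for the norm of the window kernel -/

section KernelBound

variable {Ω : Type*} [MeasurableSpace Ω] {P : Measure Ω} {V : ℕ → ℤ → Ω → ℝ} {m₀ : ℕ}
  {lam : Fin (m₀ + 2) → ℝ} {A0 : ℕ → ℤ → ℝ → ℂ} {A : ℝ → ℝ → ℂ} {mu : ℝ → ℝ}

lemma length_le_of_window_subset {T n : ℕ} {v : ℝ} (hn : Even n)
    (hw : window T n v ⊆ Set.Icc (1 : ℤ) (T : ℤ)) : n ≤ T := by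
  rcases Nat.eq_zero_or_pos n with rfl | hpos
  · exact Nat.zero_le _
  · have h0 := windowStart_add_mem hn hw hpos
    have h1 := windowStart_add_mem hn hw (Nat.sub_lt hpos one_pos)
    omega

lemma abs_window_sub_le {T n : ℕ} {v : ℝ} (hn : Even n) (hT : 0 < T) {s : ℕ} (hs : s < n) :
    |((windowStart T n v + (s : ℤ) : ℤ) : ℝ) / T - v| ≤ n / T := by
  have hT' : (0 : ℝ) < T := by exact_mod_cast hT
  obtain ⟨k, rfl⟩ := hn
  have hk : (k + k) / 2 = k := by omega
  rw [show ((windowStart T (k + k) v + (s : ℤ) : ℤ) : ℝ) / T - v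
    = (((windowStart T (k + k) v + (s : ℤ) : ℤ) : ℝ) - T * v) / T by field_simp, abs_div,
    abs_of_pos hT']
  refine div_le_div_of_nonneg_right ?_ hT'.le
  rw [windowStart, hk]
  have h1 := Int.floor_le ((T : ℝ) * v)
  have h2 := Int.lt_floor_add_one ((T : ℝ) * v)
  have h3 : (s : ℝ) + 1 ≤ k + k := by exact_mod_cast hs
  have h4 : (1 : ℝ) ≤ k := by exact_mod_cast (by omega : 1 ≤ k)
  have h5 : (0 : ℝ) ≤ s := Nat.cast_nonneg s
  push_cast
  rw [abs_le]
  constructor <;> linarith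

/-- Lower bound for the `L²` norm of the window kernel: the window consists of a long piece in the
regime of `v`, preceded by `p` and followed by `r` dates which also lie in one regime each. -/
theorem IsSLS.lpNorm_windowKernel_ge (hV : IsSLS P V lam A0 A mu) (hA : SmoothTransfer lam A) :
    ∃ C : ℝ, 0 ≤ C ∧ ∀ (T n p m r : ℕ) (v x : ℝ) (j₀ j j₁ : Fin (m₀ + 1)), Even n → 0 < n →
      window T n v ⊆ Set.Icc (1 : ℤ) (T : ℤ) → |x| ≤ Real.pi / 2 → n = p + m + r →
      v ∈ regime lam j →
      (∀ s : ℕ, s < p → ((windowStart T n v + (s : ℤ) : ℤ) : ℝ) / T ∈ regime lam j₀) →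
      (∀ s : ℕ, p ≤ s → s < p + m → ((windowStart T n v + (s : ℤ) : ℤ) : ℝ) / T ∈ regime lam j) →
      (∀ s : ℕ, p + m ≤ s → s < n → ((windowStart T n v + (s : ℤ) : ℤ) : ℝ) / T ∈ regime lam j₁) →
      Real.sqrt (2 * Real.pi) * (‖A v x‖ * Real.sqrt n) ≤
        lpNorm (windowKernel A0 T n v x) 2 bandMeasure + Real.sqrt (2 * Real.pi) *
          (C * (n / T * Real.sqrt n + Real.sqrt p + Real.sqrt r + 1)) := by
  obtain ⟨M, hM0, hM⟩ := hA.lipschitz_time hV.breaks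
  obtain ⟨L, hL0, hL⟩ := hA.lipschitz_freq
  obtain ⟨B, hB0, hB⟩ := hA.bounded hV.breaks
  obtain ⟨K, hK⟩ := hV.approx
  -- The summands pay for the approximation of A⁰ by A, the time variation on the main piece, the
  -- two end pieces, and the variation in frequency.
  refine ⟨|K| + 2 * M + (2 * B + M) + 10 * L, by positivity, ?_⟩
  intro T n p m r v x j₀ j j₁ hn hn0 hw hx hnpm hvj h₀ h h₁
  have hpi := Real.pi_pos
  have hnT := length_le_of_window_subset hn hw
  have hT : 0 < T := by omega
  have hT' : (0 : ℝ) < T := by exact_mod_cast hT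
  have hv := hV.breaks.regime_subset j hvj
  set a := windowStart T n v with ha
  set τ : ℕ → ℝ := fun s => ((a + (s : ℤ) : ℤ) : ℝ) / T with hτ
  set Q := Real.sqrt (2 * Real.pi) with hQ
  have hτ01 : ∀ s < n, τ s ∈ Set.Ioc (0 : ℝ) 1 := fun s hs => by
    obtain ⟨h1, h2⟩ := windowStart_add_mem hn hw hs
    exact ⟨div_pos (by exact_mod_cast (by omega : 0 < a + (s : ℤ))) hT',
      (div_le_one hT').2 (by exact_mod_cast h2)⟩
  have hτs : ∀ s, |τ (s + 1) - τ s| = 1 / T := fun s => by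
    rw [← sub_div, abs_div, abs_of_pos hT']
    congr 1
    push_cast
    ring_nf
    simp
  have hAm : ∀ s < n, AEStronglyMeasurable (A (τ s)) bandMeasure := fun s hs =>
    (hA.continuous_freq (hτ01 s hs)).aestronglyMeasurable
  have hAv : AEStronglyMeasurable (A v) bandMeasure :=
    (hA.continuous_freq hv).aestronglyMeasurable
  have hxI : x ∈ Set.Icc (-Real.pi) Real.pi := by
    rw [abs_le] at hx
    constructor <;> linarith [hx.1, hx.2]
  -- the approximation error
  have b1m : ∀ s ∈ Finset.range n, MemLp (fun y => (A0 T (a + (s : ℤ)) y - A (τ s) y) *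
      wave a x s y) 2 bandMeasure ∧ lpNorm (fun y => (A0 T (a + (s : ℤ)) y - A (τ s) y) *
      wave a x s y) 2 bandMeasure ≤ Q * (|K| / T) := fun s hs => by
    rw [Finset.mem_range] at hs
    obtain ⟨h1, h2⟩ := windowStart_add_mem hn hw hs
    have hm := (hV.memLp_transfer h1 h2).1.sub (hAm s hs)
    have hb : ∀ y ∈ Set.Icc (-Real.pi) Real.pi, ‖A0 T (a + (s : ℤ)) y - A (τ s) y‖ ≤ |K| / T :=
      fun y hy => (hK T _ h1 h2 y hy).trans (div_le_div_of_nonneg_right (le_abs_self K) hT'.le)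
    refine ⟨MemLp.band_bounded_mul hm hb (memLp_wave a x s), ?_⟩
    refine (lpNorm_band_bounded_mul_le hm hb (memLp_wave a x s)).trans (le_of_eq ?_)
    have := lpNorm_sum_wave a x {s}
    simp only [Finset.sum_singleton, Finset.card_singleton, Nat.cast_one, Real.sqrt_one,
      mul_one] at this
    change |K| / T * lpNorm (fun y => wave a x s y) 2 bandMeasure = _
    rw [this, mul_comm]
  have b1 : lpNorm (∑ s ∈ Finset.range n, fun y => (A0 T (a + (s : ℤ)) y - A (τ s) y) *
      wave a x s y) 2 bandMeasure ≤ Q * (|K| * (n / T)) := by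
    refine (lpNorm_sum_le (fun s hs => (b1m s hs).1) one_le_two).trans ?_
    refine (Finset.sum_le_card_nsmul _ _ _ fun s hs => (b1m s hs).2).trans (le_of_eq ?_)
    rw [nsmul_eq_mul, Finset.card_range]
    ring
  -- the variation of the transfer function
  have part : ∀ (k l : ℕ) (i : Fin (m₀ + 1)) (α : ℝ), 0 ≤ α → k + l ≤ n →
      (∀ s, k ≤ s → s < k + l → τ s ∈ regime lam i) →
      (∀ s, k ≤ s → s < k + l → ∀ y ∈ Set.Icc (-Real.pi) Real.pi, ‖A (τ s) y - A v y‖ ≤ α) →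
      lpNorm (fun y => ∑ s ∈ Finset.range l, (A (τ (k + s)) y - A v y) * wave a x (k + s) y) 2
        bandMeasure ≤ Q * ((α + M * (n / T)) * Real.sqrt l) := by
    intro k l i α hα hkl hi hαb
    refine (lpNorm_sum_amplitude_mul_wave_le a x k l (F := fun s y => A (τ (k + s)) y - A v y)
      (α := α) (β := M * (1 / T)) hα (by positivity)
      (fun s hs => (hAm _ (by omega)).sub hAv) (fun s hs => hαb _ (by omega) (by omega))
      (fun s hs y _ => ?_)).trans ?_
    · rw [sub_sub_sub_cancel_right, ← hτs (k + s)]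
      exact hM i _ (hi _ (by omega) (by omega)) _ (hi _ (by omega) (by omega)) y
    · have hl : (l : ℝ) ≤ n := by exact_mod_cast (by omega : l ≤ n)
      have : (l : ℝ) * (M * (1 / T)) ≤ M * (n / T) := by
        rw [show (l : ℝ) * (M * (1 / T)) = M * (l / T) by ring]
        gcongr
      gcongr
  have partm : ∀ (k l : ℕ), k + l ≤ n → MemLp (fun y => ∑ s ∈ Finset.range l,
      (A (τ (k + s)) y - A v y) * wave a x (k + s) y) 2 bandMeasure := fun k l hkl =>
    memLp_finsetSum _ fun s hs => by
      rw [Finset.mem_range] at hs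
      refine MemLp.band_bounded_mul (c := B + B) ((hAm _ (by omega)).sub hAv) (fun y hy => ?_)
        (memLp_wave a x _)
      exact (norm_sub_le _ _).trans (add_le_add (hB _ (hτ01 _ (by omega)) y hy) (hB v hv y hy))
  have hnT1 : (n : ℝ) / T ≤ 1 := (div_le_one hT').2 (by exact_mod_cast hnT)
  have bad : ∀ s < n, ∀ y ∈ Set.Icc (-Real.pi) Real.pi, ‖A (τ s) y - A v y‖ ≤ 2 * B :=
    fun s hs y hy => (norm_sub_le _ _).trans (by linarith [hB _ (hτ01 s hs) y hy, hB v hv y hy])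
  -- On the end pieces the regime may differ from that of `v`, so the amplitude is merely bounded by
  -- `2 * B`; the piece is cheap because it is short. On the main piece the amplitude is itself
  -- O(n/T).
  have b2 := part 0 p j₀ (2 * B) (by positivity) (by omega) (fun s _ hs => h₀ s (by omega))
    (fun s _ hs => bad s (by omega))
  have b3 := part p m j (M * (n / T)) (by positivity) (by omega) h (fun s hs hs' y _ =>
    (hM j _ (h s hs hs') _ hvj y).trans
      (mul_le_mul_of_nonneg_left (abs_window_sub_le hn hT (by omega)) hM0))
  have b4 := part (p + m) r j₁ (2 * B) (by positivity) (by omega)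
    (fun s hs hs' => h₁ s hs (by omega)) (fun s _ hs => bad s (by omega))
  -- the smoothness in frequency
  have hDm : Continuous fun y => ∑ s ∈ Finset.range n, wave a x s y :=
    continuous_finsetSum _ fun s _ => continuous_wave a x s
  have b5m : AEStronglyMeasurable (fun y => (A v y - A v x) *
      ∑ s ∈ Finset.range n, wave a x s y) bandMeasure :=
    (((hA.continuous_freq hv).sub continuous_const).mul hDm).aestronglyMeasurable
  -- The factor |y - x| from the Lipschitz bound offsets the peak of the Dirichlet kernel, so this
  -- error is bounded pointwise, uniformly in `n`.
  have b5b : ∀ y ∈ Set.Icc (-Real.pi) Real.pi, ‖(A v y - A v x) *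
      ∑ s ∈ Finset.range n, wave a x s y‖ ≤ L * 10 := fun y hy => by
    rw [norm_mul]
    calc _ ≤ L * |y - x| * ‖∑ s ∈ Finset.range n, wave a x s y‖ := by
          gcongr
          exact hL v hv y x
      _ ≤ L * 10 := by
          rw [mul_assoc]
          exact mul_le_mul_of_nonneg_left (abs_sub_mul_norm_sum_wave_le a n hx hy) hL0
  have b5 := lpNorm_band_le_of_bound b5m b5b
  -- assembling the pieces
  have hHm : MemLp (windowKernel A0 T n v x) 2 bandMeasure :=
    memLp_finsetSum _ fun s hs => by
      rw [Finset.mem_range] at hs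
      obtain ⟨h1, h2⟩ := windowStart_add_mem hn hw hs
      have := MemLp.band_bounded_mul (c := 1) (continuous_wave a x s).aestronglyMeasurable
        (fun y _ => (norm_wave a x s y).le) (hV.memLp_transfer h1 h2)
      exact this.ae_eq (Eventually.of_forall fun y => mul_comm _ _)
  have hE1m := memLp_finsetSum' (Finset.range n) fun s hs => (b1m s hs).1
  -- The frozen kernel, whose norm is known exactly, is the true kernel minus five errors; the
  -- triangle inequality then bounds the true kernel from below.
  have hdecomp : (fun y => A v x * ∑ s ∈ Finset.range n, wave a x s y) =
      ((((windowKernel A0 T n v x - ∑ s ∈ Finset.range n, fun y =>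
        (A0 T (a + (s : ℤ)) y - A (τ s) y) * wave a x s y)
      - fun y => ∑ s ∈ Finset.range p, (A (τ (0 + s)) y - A v y) * wave a x (0 + s) y)
      - fun y => ∑ s ∈ Finset.range m, (A (τ (p + s)) y - A v y) * wave a x (p + s) y)
      - fun y => ∑ s ∈ Finset.range r, (A (τ (p + m + s)) y - A v y) * wave a x (p + m + s) y)
      - fun y => (A v y - A v x) * ∑ s ∈ Finset.range n, wave a x s y := by
    funext y
    have e1 : ∑ s ∈ Finset.range n, (A (τ s) y - A v y) * wave a x s y =
        ∑ s ∈ Finset.range p, (A (τ (0 + s)) y - A v y) * wave a x (0 + s) y +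
        ∑ s ∈ Finset.range m, (A (τ (p + s)) y - A v y) * wave a x (p + s) y +
        ∑ s ∈ Finset.range r, (A (τ (p + m + s)) y - A v y) * wave a x (p + m + s) y := by
      rw [hnpm, Finset.sum_range_add, Finset.sum_range_add]
      simp only [zero_add]
    have e2 : windowKernel A0 T n v x y = ∑ s ∈ Finset.range n,
          (A0 T (a + (s : ℤ)) y - A (τ s) y) * wave a x s y
        + ∑ s ∈ Finset.range n, (A (τ s) y - A v y) * wave a x s y
        + A v y * ∑ s ∈ Finset.range n, wave a x s y := by
      rw [Finset.mul_sum, ← Finset.sum_add_distrib, ← Finset.sum_add_distrib, windowKernel]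
      refine Finset.sum_congr rfl fun s _ => ?_
      ring
    simp only [Pi.sub_apply, Finset.sum_apply]
    rw [e2, e1]
    ring
  have hlhs : lpNorm (fun y => A v x * ∑ s ∈ Finset.range n, wave a x s y) 2 bandMeasure
      = Q * (‖A v x‖ * Real.sqrt n) := by
    have := lpNorm_const_smul (A v x) (fun y => ∑ s ∈ Finset.range n, wave a x s y) bandMeasure
      (p := 2)
    have h2 := lpNorm_sum_wave a x (Finset.range n)
    rw [h2, Finset.card_range] at this
    refine Eq.trans this ?_
    simp only [coe_nnnorm]
    ring
  have m1 := hHm.sub hE1m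
  have m2 := m1.sub (partm 0 p (by omega))
  have m3 := m2.sub (partm p m (by omega))
  have m4 := m3.sub (partm (p + m) r (by omega))
  have s1 := lpNorm_sub_le hHm (g := ∑ s ∈ Finset.range n, fun y =>
    (A0 T (a + (s : ℤ)) y - A (τ s) y) * wave a x s y) one_le_two
  have s2 := lpNorm_sub_le m1 (g := fun y => ∑ s ∈ Finset.range p,
    (A (τ (0 + s)) y - A v y) * wave a x (0 + s) y) one_le_two
  have s3 := lpNorm_sub_le m2 (g := fun y => ∑ s ∈ Finset.range m,
    (A (τ (p + s)) y - A v y) * wave a x (p + s) y) one_le_two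
  have s4 := lpNorm_sub_le m3 (g := fun y => ∑ s ∈ Finset.range r,
    (A (τ (p + m + s)) y - A v y) * wave a x (p + m + s) y) one_le_two
  have s5 := lpNorm_sub_le m4 (g := fun y => (A v y - A v x) *
    ∑ s ∈ Finset.range n, wave a x s y) one_le_two
  rw [← hdecomp, hlhs] at s5
  have hQ0 : 0 ≤ Q := Real.sqrt_nonneg _
  have hsn1 : 1 ≤ Real.sqrt n := Real.one_le_sqrt.2 (by exact_mod_cast hn0)
  have hsm : Real.sqrt m ≤ Real.sqrt n := Real.sqrt_le_sqrt (by exact_mod_cast (by omega : m ≤ n))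
  have hfin : |K| * (n / T) + (2 * B + M * (n / T)) * Real.sqrt p
      + (M * (n / T) + M * (n / T)) * Real.sqrt m + (2 * B + M * (n / T)) * Real.sqrt r + L * 10
      ≤ (|K| + 2 * M + (2 * B + M) + 10 * L) *
        (n / T * Real.sqrt n + Real.sqrt p + Real.sqrt r + 1) := by
    have t0 : (0 : ℝ) ≤ n / T := by positivity
    have tp : 0 ≤ Real.sqrt p := Real.sqrt_nonneg _
    have tr : 0 ≤ Real.sqrt r := Real.sqrt_nonneg _
    have tn : 0 ≤ (n : ℝ) / T * Real.sqrt n := by positivity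
    have k0 := abs_nonneg K
    have f1 : |K| * (n / T) ≤ |K| * (n / T * Real.sqrt n) :=
      mul_le_mul_of_nonneg_left (le_mul_of_one_le_right t0 hsn1) k0
    have f2 : (M * (n / T) + M * (n / T)) * Real.sqrt m ≤ 2 * M * (n / T * Real.sqrt n) := by
      rw [show 2 * M * (n / T * Real.sqrt n) = (M * (n / T) + M * (n / T)) * Real.sqrt n by ring]
      gcongr
    have f3 : ∀ z : ℝ, 0 ≤ z → (2 * B + M * (n / T)) * z ≤ (2 * B + M) * z := fun z hz => by
      refine mul_le_mul_of_nonneg_right ?_ hz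
      have := mul_le_of_le_one_right hM0 hnT1
      linarith
    have f4 := f3 _ tp
    have f5 := f3 _ tr
    have g : ∀ c z : ℝ, 0 ≤ c → c ≤ |K| + 2 * M + (2 * B + M) + 10 * L → 0 ≤ z →
        c * z ≤ (|K| + 2 * M + (2 * B + M) + 10 * L) * z := fun c z _ hc hz =>
      mul_le_mul_of_nonneg_right hc hz
    have g1 := g (|K| + 2 * M) (n / T * Real.sqrt n) (by positivity) (by linarith) tn
    have g2 := g (2 * B + M) _ (by positivity) (by linarith) tp
    have g3 := g (2 * B + M) _ (by positivity) (by linarith) tr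
    have g4 := g (10 * L) 1 (by positivity) (by linarith) zero_le_one
    linarith
  have := mul_le_mul_of_nonneg_left hfin hQ0
  linarith

end KernelBound

/-! ### From the kernel bound to the spectral density -/

section LowerBound

variable {Ω : Type*} [MeasurableSpace Ω] {P : Measure Ω} {V : ℕ → ℤ → Ω → ℝ} {m₀ : ℕ}
  {lam : Fin (m₀ + 2) → ℝ} {A0 : ℕ → ℤ → ℝ → ℂ} {A : ℝ → ℝ → ℂ} {mu : ℝ → ℝ}

/-- The trend contributes a nonnegative term, which is dropped; no regularity of the trend is
involved. -/
lemma IsSLS.sqrt_meanLocalPeriodogram_ge [IsProbabilityMeasure P] (hV : IsSLS P V lam A0 A mu)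
    {T n : ℕ} {v : ℝ} (hn : Even n) (hn0 : 0 < n)
    (hw : window T n v ⊆ Set.Icc (1 : ℤ) (T : ℤ)) (x : ℝ) :
    lpNorm (windowKernel A0 T n v x) 2 bandMeasure ≤
      Real.sqrt (meanLocalPeriodogram P V T n v x) * Real.sqrt n := by
  have hn' : (0 : ℝ) < n := by exact_mod_cast hn0
  rw [hV.meanLocalPeriodogram_eq hn hw, ← Real.sqrt_mul' _ hn'.le]
  refine Real.le_sqrt_of_sq_le ?_
  field_simp
  linarith [sq_nonneg ‖trendTransform mu T n v x‖]

/-- The mean periodogram dominates the spectral density when, up to an asymptotically negligible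
number of dates at both ends, the window lies in the regime of its center. -/
theorem IsSLS.boundedBelow_of_pieces [IsProbabilityMeasure P] (hV : IsSLS P V lam A0 A mu)
    (hA : SmoothTransfer lam A) {n : ℕ → ℕ} (hn_even : ∀ T, Even (n T))
    (hn : Tendsto n atTop atTop)
    (hnT : Tendsto (fun T : ℕ => (n T : ℝ) / (T : ℝ)) atTop (𝓝 0))
    {u : ℕ → ℝ} (hu : ∀ T, u T ∈ Set.Ioo (0 : ℝ) 1)
    (hwin : ∀ᶠ T : ℕ in atTop, window T (n T) (u T) ⊆ Set.Icc (1 : ℤ) (T : ℤ))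
    {p r : ℕ → ℕ} (hp : Tendsto (fun T => (p T : ℝ) / n T) atTop (𝓝 0))
    (hr : Tendsto (fun T => (r T : ℝ) / n T) atTop (𝓝 0))
    (hpieces : ∀ᶠ T in atTop, ∃ (m : ℕ) (j₀ j j₁ : Fin (m₀ + 1)), n T = p T + m + r T ∧
      u T ∈ regime lam j ∧
      (∀ s : ℕ, s < p T → ((windowStart T (n T) (u T) + (s : ℤ) : ℤ) : ℝ) / T ∈ regime lam j₀) ∧
      (∀ s : ℕ, p T ≤ s → s < p T + m →
        ((windowStart T (n T) (u T) + (s : ℤ) : ℤ) : ℝ) / T ∈ regime lam j) ∧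
      (∀ s : ℕ, p T + m ≤ s → s < n T →
        ((windowStart T (n T) (u T) + (s : ℤ) : ℤ) : ℝ) / T ∈ regime lam j₁)) :
    BoundedBelowBySpecDensity P V A n u := by
  intro l _ hω
  obtain ⟨C, hC0, hC⟩ := hV.lpNorm_windowKernel_ge hA
  obtain ⟨L, hL0, hL⟩ := hA.lipschitz_freq
  have hpi := Real.pi_pos
  -- The error of the kernel bound divided by √n.
  set err : ℕ → ℝ := fun T => C * ((n T : ℝ) / T + Real.sqrt (p T / n T) + Real.sqrt (r T / n T)
    + 1 / Real.sqrt (n T)) with herr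
  have hnR : Tendsto (fun T => (n T : ℝ)) atTop atTop := tendsto_natCast_atTop_atTop.comp hn
  have herr0 : Tendsto err atTop (𝓝 0) := by
    have e1 := (Real.continuous_sqrt.tendsto 0).comp hp
    have e2 := (Real.continuous_sqrt.tendsto 0).comp hr
    have e3 : Tendsto (fun T => 1 / Real.sqrt (n T : ℝ)) atTop (𝓝 0) := by
      simp only [one_div]
      exact tendsto_inv_atTop_zero.comp (Real.tendsto_sqrt_atTop.comp hnR)
    rw [Real.sqrt_zero] at e1 e2
    have e4 := (((hnT.add e1).add e2).add e3).const_mul C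
    simp only [add_zero, mul_zero] at e4
    exact e4
  have hω2 : ∀ᶠ T in atTop, |fourierFreq (n T) (l T)| ≤ Real.pi / 2 := by
    have := hω.abs
    rw [abs_zero] at this
    exact this.eventually_le_const (by positivity)
  have key : ∀ᶠ T in atTop, 2 * err T ≤ ‖A (u T) (fourierFreq (n T) (l T))‖ →
      specDensity A (u T) (fourierFreq (n T) (l T)) ≤
        meanLocalPeriodogram P V T (n T) (u T) (fourierFreq (n T) (l T)) := by
    filter_upwards [hwin, hω2, hpieces, hn.eventually_gt_atTop 0] with T hw hx
      ⟨m, j₀, j, j₁, hsum, huj, h0, h1, h2⟩ hn0 hle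
    have hmain := hC T (n T) (p T) m (r T) (u T) _ j₀ j j₁ (hn_even T) hn0 hw hx hsum huj h0 h1 h2
    have hsq := hV.sqrt_meanLocalPeriodogram_ge (hn_even T) hn0 hw (fourierFreq (n T) (l T))
    set y := ‖A (u T) (fourierFreq (n T) (l T))‖ with hy
    set E := meanLocalPeriodogram P V T (n T) (u T) (fourierFreq (n T) (l T)) with hE
    have hE0 : 0 ≤ E := integral_nonneg fun ω => by
      unfold localPeriodogram
      positivity
    have hn' : (0 : ℝ) < n T := by exact_mod_cast hn0
    have hs : 0 < Real.sqrt (n T) := Real.sqrt_pos.2 hn'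
    have herrT : C * ((n T : ℝ) / T * Real.sqrt (n T) + Real.sqrt (p T) + Real.sqrt (r T) + 1)
        = err T * Real.sqrt (n T) := by
      simp only [herr]
      rw [Real.sqrt_div (by positivity), Real.sqrt_div (by positivity)]
      field_simp
    rw [herrT] at hmain
    have h3 : Real.sqrt (2 * Real.pi) * (y - err T) * Real.sqrt (n T)
        ≤ Real.sqrt E * Real.sqrt (n T) := by
      nlinarith
    have h4 := le_of_mul_le_mul_right h3 hs
    -- Since 2π > 4, the bound √E ≥ √(2π) (y - err) ≥ 2 (y - err) is at least y once y ≥ 2 err.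
    have h5 : 2 ≤ Real.sqrt (2 * Real.pi) :=
      Real.le_sqrt_of_sq_le (by linarith [Real.pi_gt_three])
    have hy0 : 0 ≤ y := norm_nonneg _
    have h6 : 0 ≤ y - err T := by linarith
    have h7 : y ≤ Real.sqrt E := by nlinarith
    calc specDensity A (u T) (fourierFreq (n T) (l T)) = y ^ 2 := rfl
      _ ≤ Real.sqrt E ^ 2 := by gcongr
      _ = E := Real.sq_sqrt hE0
  refine ⟨fun ε hε => ?_, fun ⟨c, hc, hcT⟩ => ?_⟩
  · have h4 : Tendsto (fun T => (2 * err T) ^ 2) atTop (𝓝 0) := by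
      simpa using (herr0.const_mul 2).pow 2
    filter_upwards [key, h4.eventually_lt_const hε] with T hk hεT
    -- Either the inequality holds without error, or f is below (2 err)², which tends to zero.
    rcases le_or_gt (2 * err T) ‖A (u T) (fourierFreq (n T) (l T))‖ with h | h
    · linarith [hk h]
    · have hE0 : 0 ≤ meanLocalPeriodogram P V T (n T) (u T) (fourierFreq (n T) (l T)) :=
        integral_nonneg fun ω => by
          unfold localPeriodogram
          positivity
      have : specDensity A (u T) (fourierFreq (n T) (l T)) ≤ (2 * err T) ^ 2 := by
        unfold specDensity
        gcongr
      linarith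
  · have h5 : Tendsto (fun T => 2 * err T + L * |fourierFreq (n T) (l T)|) atTop (𝓝 0) := by
      simpa using (herr0.const_mul 2).add (hω.abs.const_mul L)
    filter_upwards [key, h5.eventually_lt_const (Real.sqrt_pos.2 hc), hcT] with T hk h5T hcT
    refine hk ?_
    have h6 : Real.sqrt c ≤ ‖A (u T) 0‖ := Real.sqrt_le_iff.2 ⟨norm_nonneg _, hcT⟩
    have h7 := hL (u T) ⟨(hu T).1, (hu T).2.le⟩ 0 (fourierFreq (n T) (l T))
    rw [zero_sub, abs_neg] at h7
    have h8 := norm_sub_norm_le (A (u T) 0) (A (u T) (fourierFreq (n T) (l T)))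
    linarith

end LowerBound

/-! ### Cutting a window at its break -/

section WindowPieces

variable {m₀ : ℕ} {lam : Fin (m₀ + 2) → ℝ}

/-- A break date still belongs to the earlier regime, so a break at the last date of the piece does
no harm; hence the `+ 1` in the hypothesis. -/
lemma IsBreakFractions.exists_regime_of_window_piece (h : IsBreakFractions lam) {T n : ℕ} {v : ℝ}
    (hn : Even n) (hw : window T n v ⊆ Set.Icc (1 : ℤ) (T : ℤ)) {k l : ℕ} (hkl : k + l ≤ n)
    (hno : ∀ i : Fin m₀, ¬ (windowStart T n v + k ≤ breakDate lam T i ∧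
      breakDate lam T i + 1 < windowStart T n v + k + l)) :
    ∃ j, ∀ s : ℕ, k ≤ s → s < k + l →
      ((windowStart T n v + (s : ℤ) : ℤ) : ℝ) / T ∈ regime lam j := by
  rcases Nat.eq_zero_or_pos l with rfl | hl
  · exact ⟨0, fun s h1 h2 => by omega⟩
  obtain ⟨j, hj⟩ := h.exists_common_regime (T := T) (p := windowStart T n v + k)
    (q := windowStart T n v + k + l - 1) (windowStart_add_mem hn hw (by omega)).1 (by omega)
    (by
      have := (windowStart_add_mem hn hw (s := k + l - 1) (by omega)).2
      omega)
    (fun i hi => hno i ⟨hi.1, by omega⟩)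
  exact ⟨j, fun s h1 h2 => hj _ (by omega) (by omega)⟩

/-- The bounds on `p` and `p + m` place the positions `n / 2 - 1` and `n / 2`, that is the dates
⌊Tv⌋ and ⌊Tv⌋ + 1, in the middle piece; this puts `v` itself into the regime of that piece. -/
lemma IsBreakFractions.exists_window_pieces (h : IsBreakFractions lam) {T n p m r : ℕ} {v : ℝ}
    (hn : Even n) (hw : window T n v ⊆ Set.Icc (1 : ℤ) (T : ℤ)) (hsum : n = p + m + r)
    (hp : p + 1 ≤ n / 2) (hm : n / 2 + 1 ≤ p + m)
    (hno : ∀ i : Fin m₀, breakDate lam T i ∈ window T n v →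
      breakDate lam T i + 1 = windowStart T n v + p ∨
      breakDate lam T i + 1 = windowStart T n v + p + m) :
    ∃ (m : ℕ) (j₀ j j₁ : Fin (m₀ + 1)), n = p + m + r ∧ v ∈ regime lam j ∧
      (∀ s : ℕ, s < p → ((windowStart T n v + (s : ℤ) : ℤ) : ℝ) / T ∈ regime lam j₀) ∧
      (∀ s : ℕ, p ≤ s → s < p + m →
        ((windowStart T n v + (s : ℤ) : ℤ) : ℝ) / T ∈ regime lam j) ∧
      (∀ s : ℕ, p + m ≤ s → s < n →
        ((windowStart T n v + (s : ℤ) : ℤ) : ℝ) / T ∈ regime lam j₁) := by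
  have hmem : ∀ t : ℤ, windowStart T n v ≤ t → t < windowStart T n v + n → t ∈ window T n v := by
    intro t h1 h2
    obtain ⟨k, rfl⟩ := hn
    simp only [window, windowStart, Set.mem_Icc] at *
    omega
  obtain ⟨j₀, hj₀⟩ := h.exists_regime_of_window_piece hn hw (k := 0) (l := p) (by omega)
    (fun i hi => by
      have := hno i (hmem _ (by omega) (by omega))
      omega)
  obtain ⟨j, hj⟩ := h.exists_regime_of_window_piece hn hw (k := p) (l := m) (by omega)
    (fun i hi => by
      have := hno i (hmem _ (by omega) (by omega))
      omega)
  obtain ⟨j₁, hj₁⟩ := h.exists_regime_of_window_piece hn hw (k := p + m) (l := r) (by omega)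
    (fun i hi => by
      have := hno i (hmem _ (by omega) (by omega))
      omega)
  have hT : 0 < T := by
    have := length_le_of_window_subset hn hw
    omega
  refine ⟨m, j₀, j, j₁, hsum, ?_, fun s hs => hj₀ s (by omega) (by omega), hj,
    fun s h1 h2 => hj₁ s h1 (by omega)⟩
  refine mem_regime_of_floor_mem hT ?_ ?_
  · have := hj (n / 2 - 1) (by omega) (by omega)
    rwa [show windowStart T n v + ((n / 2 - 1 : ℕ) : ℤ) = ⌊(T : ℝ) * v⌋ by
      rw [windowStart]; omega] at this
  · have := hj (n / 2) (by omega) (by omega)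
    rwa [show windowStart T n v + ((n / 2 : ℕ) : ℤ) = ⌊(T : ℝ) * v⌋ + 1 by
      rw [windowStart]; omega] at this

/-- Short windows contain at most one break. -/
lemma IsBreakFractions.eventually_unique_break (h : IsBreakFractions lam) {n : ℕ → ℕ}
    (hn_even : ∀ T, Even (n T))
    (hnT : Tendsto (fun T : ℕ => (n T : ℝ) / (T : ℝ)) atTop (𝓝 0)) (u : ℕ → ℝ) :
    ∀ᶠ T in atTop, ∀ i j : Fin m₀, breakDate lam T i ∈ window T (n T) (u T) →
      breakDate lam T j ∈ window T (n T) (u T) → i = j := by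
  have hlt : ∀ i j : Fin m₀, i < j → ∀ᶠ T in atTop,
      ¬ (breakDate lam T i ∈ window T (n T) (u T) ∧ breakDate lam T j ∈ window T (n T) (u T)) := by
    intro i j hij
    have hδ : 0 < lam j.succ.castSucc - lam i.succ.castSucc :=
      sub_pos.2 (h.strictMono (Fin.castSucc_lt_castSucc_iff.2 (Fin.succ_lt_succ_iff.2 hij)))
    filter_upwards [hnT.eventually_lt_const hδ, eventually_gt_atTop 0] with T hT hT0 hmem
    have hT' : (0 : ℝ) < T := by exact_mod_cast hT0
    rw [div_lt_iff₀ hT'] at hT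
    have h1 := Int.floor_le ((T : ℝ) * lam i.succ.castSucc)
    have h2 := Int.lt_floor_add_one ((T : ℝ) * lam j.succ.castSucc)
    -- Two dates of the window are less than n apart, whereas n < T(λ_j - λ_i); the `+ 1`
    -- compensates the rounding of the break dates.
    have h3 : breakDate lam T j + 1 ≤ breakDate lam T i + n T := by
      obtain ⟨k, hk⟩ := hn_even T
      simp only [window, windowStart, Set.mem_Icc] at hmem
      omega
    have h4 : ((breakDate lam T j : ℤ) : ℝ) + 1 ≤ (breakDate lam T i : ℤ) + n T := by
      exact_mod_cast h3
    unfold breakDate at h4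
    nlinarith
  have hall : ∀ᶠ T in atTop, ∀ i j : Fin m₀, i < j →
      ¬ (breakDate lam T i ∈ window T (n T) (u T) ∧ breakDate lam T j ∈ window T (n T) (u T)) := by
    simp only [eventually_all]
    exact hlt
  filter_upwards [hall] with T hT i j hi hj
  rcases lt_trichotomy i j with hij | hij | hij
  · exact absurd ⟨hi, hj⟩ (hT i j hij)
  · exact hij
  · exact absurd ⟨hj, hi⟩ (hT j i hij)

end WindowPieces

/-! ### Windows without a break or with a break near the boundary -/

section BoundedBelow

variable {Ω : Type*} [MeasurableSpace Ω] {P : Measure Ω} {V : ℕ → ℤ → Ω → ℝ} {m₀ : ℕ}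
  {lam : Fin (m₀ + 2) → ℝ} {A0 : ℕ → ℤ → ℝ → ℂ} {A : ℝ → ℝ → ℂ} {mu : ℝ → ℝ}

theorem IsSLS.boundedBelow_of_no_break [IsProbabilityMeasure P] (hV : IsSLS P V lam A0 A mu)
    (hA : SmoothTransfer lam A) {n : ℕ → ℕ} (hn_even : ∀ T, Even (n T))
    (hn : Tendsto n atTop atTop)
    (hnT : Tendsto (fun T : ℕ => (n T : ℝ) / (T : ℝ)) atTop (𝓝 0))
    {u : ℕ → ℝ} (hu : ∀ T, u T ∈ Set.Ioo (0 : ℝ) 1)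
    (hwin : ∀ᶠ T : ℕ in atTop, window T (n T) (u T) ⊆ Set.Icc (1 : ℤ) (T : ℤ))
    (hno : ∀ᶠ T in atTop, ∀ j : Fin m₀, breakDate lam T j ∉ window T (n T) (u T)) :
    BoundedBelowBySpecDensity P V A n u := by
  refine hV.boundedBelow_of_pieces hA hn_even hn hnT hu hwin (p := 0) (r := 0) (by simp) (by simp) ?_
  filter_upwards [hwin, hno, hn.eventually_ge_atTop 2] with T hw hT hn2
  exact hV.breaks.exists_window_pieces (m := n T) (hn_even T) hw (by simp) (by simp; omega)
    (by simp; omega) (fun i hi => absurd hi (hT i))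

lemma tendsto_one_div_length {n : ℕ → ℕ} (hn : Tendsto n atTop atTop) :
    Tendsto (fun T => 1 / (n T : ℝ)) atTop (𝓝 0) := by
  simp only [one_div]
  exact tendsto_inv_atTop_zero.comp ((tendsto_natCast_atTop_atTop (R := ℝ)).comp hn)

lemma leftPosition_eq {T n : ℕ} {v : ℝ} {j : Fin m₀}
    (hj : breakDate lam T j ∈ window T n v) :
    leftPosition lam T n v j = ((breakDate lam T j - windowStart T n v).toNat : ℝ) / n := by
  have h0 : 0 ≤ breakDate lam T j - windowStart T n v := by
    simp only [window, Set.mem_Icc] at hj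
    omega
  rw [leftPosition]
  congr 1
  exact_mod_cast (Int.toNat_of_nonneg h0).symm

lemma rightPosition_eq {T n : ℕ} {v : ℝ} {j : Fin m₀} (hn : Even n) (hn0 : 0 < n) :
    rightPosition lam T n v j = 1 - leftPosition lam T n v j := by
  have hn' : (n : ℝ) ≠ 0 := by exact_mod_cast hn0.ne'
  rw [rightPosition, leftPosition, eq_sub_iff_add_eq, ← add_div, div_eq_one_iff_eq hn']
  obtain ⟨k, rfl⟩ := hn
  rw [windowStart]
  norm_cast
  omega

/-- The break is eventually the only one in the window and cuts off o(n) dates at one end: `d + 1`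
on the left, since the break date belongs to the earlier regime, or `n - (d + 1)` on the right. -/
theorem IsSLS.boundedBelow_of_boundary_break [IsProbabilityMeasure P]
    (hV : IsSLS P V lam A0 A mu)
    (hA : SmoothTransfer lam A) {n : ℕ → ℕ} (hn_even : ∀ T, Even (n T))
    (hn : Tendsto n atTop atTop)
    (hnT : Tendsto (fun T : ℕ => (n T : ℝ) / (T : ℝ)) atTop (𝓝 0))
    {u : ℕ → ℝ} (hu : ∀ T, u T ∈ Set.Ioo (0 : ℝ) 1)
    (hwin : ∀ᶠ T : ℕ in atTop, window T (n T) (u T) ⊆ Set.Icc (1 : ℤ) (T : ℤ)) {j : Fin m₀}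
    (hj : ∀ᶠ T in atTop, breakDate lam T j ∈ window T (n T) (u T))
    (hpos : Tendsto (fun T => leftPosition lam T (n T) (u T) j) atTop (𝓝 0) ∨
      Tendsto (fun T => rightPosition lam T (n T) (u T) j) atTop (𝓝 0)) :
    BoundedBelowBySpecDensity P V A n u := by
  set d : ℕ → ℕ := fun T => (breakDate lam T j - windowStart T (n T) (u T)).toNat with hd
  have hdT : ∀ᶠ T in atTop, breakDate lam T j = windowStart T (n T) (u T) + d T ∧ d T < n T ∧
      leftPosition lam T (n T) (u T) j = (d T : ℝ) / n T := by
    filter_upwards [hj] with T hT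
    refine ⟨?_, ?_, leftPosition_eq hT⟩ <;>
    · simp only [window, Set.mem_Icc] at hT
      simp only [hd, windowStart] at hT ⊢
      have := hn_even T
      obtain ⟨k, hk⟩ := this
      omega
  have huniq := hV.breaks.eventually_unique_break hn_even hnT u
  have hone := tendsto_one_div_length hn
  rcases hpos with hpos | hpos
  · have hlim : Tendsto (fun T => ((d T + 1 : ℕ) : ℝ) / n T) atTop (𝓝 0) := by
      have := hpos.add hone
      rw [add_zero] at this
      refine this.congr' ?_
      filter_upwards [hdT] with T hT
      rw [hT.2.2]
      push_cast
      ring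
    refine hV.boundedBelow_of_pieces hA hn_even hn hnT hu hwin (p := fun T => d T + 1) (r := 0)
      hlim (by simp) ?_
    -- A cut-off piece shorter than n/8 leaves both central dates in the long piece once n ≥ 16.
    filter_upwards [hwin, hj, hdT, huniq, hn.eventually_ge_atTop 16,
      hlim.eventually_lt_const (by norm_num : (0 : ℝ) < 1 / 8)] with T hw hjT ⟨hd1, hd2, _⟩ hun hn2 h8
    have hnR : (0 : ℝ) < n T := by exact_mod_cast (by omega : 0 < n T)
    rw [div_lt_iff₀ hnR] at h8
    have h8' : 8 * (d T + 1) < n T := by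
      have : (8 : ℝ) * ((d T + 1 : ℕ) : ℝ) < n T := by linarith
      exact_mod_cast this
    refine hV.breaks.exists_window_pieces (m := n T - (d T + 1)) (hn_even T) hw ?_ (by omega)
      (by omega) (fun i hi => Or.inl ?_)
    · simp only [Pi.zero_apply]
      omega
    · rw [hun i j hi hjT, hd1]
      push_cast
      ring
  · have hlim : Tendsto (fun T => ((n T - (d T + 1) : ℕ) : ℝ) / n T) atTop (𝓝 0) := by
      refine tendsto_of_tendsto_of_tendsto_of_le_of_le' tendsto_const_nhds hpos
        (Eventually.of_forall fun T => by positivity) ?_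
      filter_upwards [hdT, hn.eventually_gt_atTop 0] with T hT hn0
      have hnR : (0 : ℝ) < n T := by exact_mod_cast hn0
      rw [rightPosition_eq (hn_even T) hn0, hT.2.2, one_sub_div hnR.ne', Nat.cast_sub (by omega)]
      gcongr
      linarith
    refine hV.boundedBelow_of_pieces hA hn_even hn hnT hu hwin (p := 0)
      (r := fun T => n T - (d T + 1)) (by simp) hlim ?_
    filter_upwards [hwin, hj, hdT, huniq, hn.eventually_ge_atTop 16,
      hlim.eventually_lt_const (by norm_num : (0 : ℝ) < 1 / 8)] with T hw hjT ⟨hd1, hd2, _⟩ hun hn2 h8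
    have hnR : (0 : ℝ) < n T := by exact_mod_cast (by omega : 0 < n T)
    rw [div_lt_iff₀ hnR] at h8
    have h8' : 8 * (n T - (d T + 1)) < n T := by
      have : (8 : ℝ) * ((n T - (d T + 1) : ℕ) : ℝ) < n T := by linarith
      exact_mod_cast this
    refine hV.breaks.exists_window_pieces (m := d T + 1) (hn_even T) hw ?_ ?_ ?_
      (fun i hi => Or.inr ?_)
    · simp only [Pi.zero_apply]
      omega
    · simp only [Pi.zero_apply]
      omega
    · simp only [Pi.zero_apply]
      omega
    · rw [hun i j hi hjT, hd1]
      simp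
      ring

end BoundedBelow

/-! ### Divergence at an interior break -/

section Divergence

variable {Ω : Type*} [MeasurableSpace Ω] {P : Measure Ω} {V : ℕ → ℤ → Ω → ℝ} {m₀ : ℕ}
  {lam : Fin (m₀ + 2) → ℝ} {A0 : ℕ → ℤ → ℝ → ℂ} {A : ℝ → ℝ → ℂ} {mu : ℝ → ℝ}

/-- Subtracting the nearest integer changes only the sign of the sine and brings the argument into
[-π/2, π/2], where Jordan's inequality applies. -/
lemma two_mul_le_abs_sin_pi_mul {y ε : ℝ} (h : ∀ k : ℤ, ε ≤ |y - k|) :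
    2 * ε ≤ |Real.sin (Real.pi * y)| := by
  have hpi := Real.pi_pos
  have h1 : |y - round y| ≤ 1 / 2 := abs_sub_round y
  have h2 : |Real.sin (Real.pi * (y - round y))| = |Real.sin (Real.pi * y)| := by
    rw [mul_sub, mul_comm Real.pi (round y : ℝ), Real.sin_sub_int_mul_pi, abs_mul, abs_zpow]
    simp
  have h3 := Real.mul_abs_le_abs_sin (x := Real.pi * (y - round y)) (by
    rw [abs_mul, abs_of_pos hpi]
    nlinarith)
  rw [h2, abs_mul, abs_of_pos hpi] at h3
  have h4 : 2 / Real.pi * (Real.pi * |y - round y|) = 2 * |y - round y| := by field_simp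
  linarith [h (round y)]

lemma Admissible.fourierFreq_ne_zero {n : ℕ} {l : ℤ} (hn : 0 < n) (hl : Admissible n l) :
    fourierFreq n l ≠ 0 := by
  have hn' : (n : ℝ) ≠ 0 := by exact_mod_cast hn.ne'
  have hl0 : (l : ℝ) ≠ 0 := by
    intro h
    exact hl.1 (by rw [Int.cast_eq_zero.1 h]; exact dvd_zero _)
  unfold fourierFreq
  have := Real.pi_ne_zero
  positivity

lemma norm_cexp_neg_I_mul_sub_one (t : ℝ) :
    ‖Complex.exp (-Complex.I * (t : ℂ)) - 1‖ = 2 * |Real.sin (t / 2)| := by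
  have := Complex.norm_exp_I_mul_ofReal_sub_one (-t)
  rw [show -Complex.I * (t : ℂ) = Complex.I * ((-t : ℝ) : ℂ) by push_cast; ring, this, norm_mul,
    Real.norm_eq_abs, Real.norm_eq_abs, neg_div, Real.sin_neg, abs_neg]
  norm_num

lemma cexp_neg_I_mul_natCast (x : ℝ) (s : ℕ) :
    Complex.exp (-Complex.I * (x : ℂ) * (s : ℂ)) = Complex.exp (-Complex.I * (x : ℂ)) ^ s := by
  rw [← Complex.exp_nat_mul, mul_comm]

/-- The Fourier sum over an initial piece of the window. -/
lemma two_mul_abs_sin_le_abs_mul_norm_sum (x : ℝ) (k : ℕ) :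
    2 * |Real.sin (k * x / 2)| ≤
      |x| * ‖∑ s ∈ Finset.range k, Complex.exp (-Complex.I * (x : ℂ) * (s : ℂ))‖ := by
  have h1 : ‖Complex.exp (-Complex.I * (x : ℂ)) - 1‖ ≤ |x| := by
    rw [norm_cexp_neg_I_mul_sub_one]
    have := Real.abs_sin_le_abs (x := x / 2)
    rw [abs_div, abs_two] at this
    linarith
  simp only [cexp_neg_I_mul_natCast]
  calc 2 * |Real.sin (k * x / 2)| = ‖Complex.exp (-Complex.I * ((k * x : ℝ) : ℂ)) - 1‖ :=
        (norm_cexp_neg_I_mul_sub_one _).symm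
    _ = ‖Complex.exp (-Complex.I * (x : ℂ)) ^ k - 1‖ := by
        rw [← Complex.exp_nat_mul]
        congr 3
        push_cast
        ring
    _ = ‖Complex.exp (-Complex.I * (x : ℂ)) - 1‖ *
          ‖∑ s ∈ Finset.range k, Complex.exp (-Complex.I * (x : ℂ)) ^ s‖ := by
        rw [← geom_sum_mul, norm_mul, mul_comm]
    _ ≤ _ := by gcongr

/-- A geometric sum whose ratio is an n-th root of unity other than 1. It removes the common level
from the transform of a jump, which leaves only the difference of levels. -/
lemma sum_cexp_fourierFreq_eq_zero {n : ℕ} {l : ℤ} (hn : 0 < n) (hl : ¬ ((n : ℤ) ∣ l)) :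
    ∑ s ∈ Finset.range n, Complex.exp (-Complex.I * (fourierFreq n l : ℂ) * (s : ℂ)) = 0 := by
  have hn' : (n : ℂ) ≠ 0 := by exact_mod_cast hn.ne'
  have hpi : (Real.pi : ℂ) ≠ 0 := by exact_mod_cast Real.pi_ne_zero
  simp only [cexp_neg_I_mul_natCast]
  have hz : Complex.exp (-Complex.I * (fourierFreq n l : ℂ)) - 1 ≠ 0 := by
    intro h
    obtain ⟨k, hk⟩ := Complex.exp_eq_one_iff.1 (sub_eq_zero.1 h)
    apply hl
    refine ⟨-k, ?_⟩
    have h2 : (2 * Real.pi * Complex.I) * (l : ℂ) = (2 * Real.pi * Complex.I) * (n * (-k)) := by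
      have h3 : -Complex.I * (fourierFreq n l : ℂ) * n = k * (2 * Real.pi * Complex.I) * n := by
        rw [hk]
      unfold fourierFreq at h3
      push_cast at h3
      field_simp at h3
      linear_combination (-2 * Real.pi * Complex.I) * h3
    have h4 := mul_left_cancel₀ (by simp) h2
    exact_mod_cast h4
  have hone : Complex.exp (-Complex.I * (fourierFreq n l : ℂ)) ^ n = 1 := by
    rw [← Complex.exp_nat_mul, Complex.exp_eq_one_iff]
    refine ⟨-l, ?_⟩
    unfold fourierFreq
    push_cast
    field_simp
  have := geom_sum_mul (Complex.exp (-Complex.I * (fourierFreq n l : ℂ))) n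
  rw [hone, sub_self] at this
  exact (mul_eq_zero.1 this).resolve_right hz

lemma sum_range_ite_mul {n k : ℕ} (hk : k ≤ n) (b c : ℂ) (e : ℕ → ℂ) :
    ∑ s ∈ Finset.range n, (if s < k then b else c) * e s
      = (b - c) * ∑ s ∈ Finset.range k, e s + c * ∑ s ∈ Finset.range n, e s := by
  obtain ⟨r, rfl⟩ := Nat.exists_eq_add_of_le hk
  rw [Finset.sum_range_add, Finset.sum_range_add,
    Finset.sum_congr rfl (g := fun s => b * e s) fun s hs => by
      rw [if_pos (Finset.mem_range.1 hs)], ← Finset.mul_sum]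
  simp only [add_lt_iff_neg_left, not_lt_zero, if_false]
  rw [← Finset.mul_sum]
  ring

/-- Lower bound for the mean periodogram when the trend transform dominates that of a jump from
`b` to `c` after `k` dates. -/
lemma IsSLS.meanLocalPeriodogram_ge_of_jump [IsProbabilityMeasure P]
    (hV : IsSLS P V lam A0 A mu) {T n : ℕ} {v : ℝ} (hn : Even n) (hn0 : 0 < n)
    (hw : window T n v ⊆ Set.Icc (1 : ℤ) (T : ℤ)) {j : Fin m₀}
    {l : ℤ} (hl : Admissible n l) {k : ℕ} (hk : breakDate lam T j + 1 = windowStart T n v + k)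
    (hkn : k ≤ n) {b c : ℝ}
    (hjump : ‖∑ s ∈ Finset.range n,
        ((if windowStart T n v + (s : ℤ) ≤ breakDate lam T j then b else c : ℝ) : ℂ) *
          Complex.exp (-Complex.I * (fourierFreq n l : ℂ) * (s : ℂ))‖ ^ 2
      ≤ ‖trendTransform mu T n v (fourierFreq n l)‖ ^ 2)
    {ε : ℝ} (hε : 0 ≤ ε) (hdist : ∀ i : ℤ, ε ≤ |(l : ℝ) * (k / n) - i|) :
    16 * (b - c) ^ 2 * ε ^ 2 * (n * fourierFreq n l ^ 2)⁻¹ ≤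
      meanLocalPeriodogram P V T n v (fourierFreq n l) := by
  have hn' : (0 : ℝ) < n := by exact_mod_cast hn0
  set x := fourierFreq n l with hx
  have hx0 : x ≠ 0 := hl.fourierFreq_ne_zero hn0
  have hsum : ∑ s ∈ Finset.range n,
        ((if windowStart T n v + (s : ℤ) ≤ breakDate lam T j then b else c : ℝ) : ℂ) *
          Complex.exp (-Complex.I * (x : ℂ) * (s : ℂ))
      = ((b - c : ℝ) : ℂ) * ∑ s ∈ Finset.range k, Complex.exp (-Complex.I * (x : ℂ) * (s : ℂ)) := by
    have h1 := sum_range_ite_mul hkn (b : ℂ) (c : ℂ)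
      (fun s => Complex.exp (-Complex.I * (x : ℂ) * (s : ℂ)))
    rw [sum_cexp_fourierFreq_eq_zero hn0 hl.1, mul_zero, add_zero] at h1
    push_cast
    rw [← h1]
    refine Finset.sum_congr rfl fun s _ => ?_
    congr 1
    by_cases h : s < k
    · rw [if_pos h, if_pos (by omega)]
    · rw [if_neg h, if_neg (by omega)]
  rw [hsum, norm_mul, Complex.norm_real, mul_pow, Real.norm_eq_abs, sq_abs] at hjump
  set D := ‖∑ s ∈ Finset.range k, Complex.exp (-Complex.I * (x : ℂ) * (s : ℂ))‖ with hD
  -- Half the phase accumulated over `k` dates is kx/2 = π l k/n, so its sine is controlled by the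
  -- distance of lk/n to the integers.
  have hD1 : 4 * ε ≤ |x| * D := by
    have h1 := two_mul_abs_sin_le_abs_mul_norm_sum x k
    have h2 := two_mul_le_abs_sin_pi_mul hdist
    rw [show Real.pi * ((l : ℝ) * (k / n)) = k * x / 2 by
      rw [hx, fourierFreq]; field_simp] at h2
    linarith
  have hD2 : 16 * ε ^ 2 ≤ x ^ 2 * D ^ 2 := by
    have := pow_le_pow_left₀ (by positivity) hD1 2
    rw [mul_pow, mul_pow, sq_abs] at this
    linarith
  rw [hV.meanLocalPeriodogram_eq hn hw, ← div_eq_mul_inv, div_le_iff₀ (by positivity)]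
  calc 16 * (b - c) ^ 2 * ε ^ 2 = (b - c) ^ 2 * (16 * ε ^ 2) := by ring
    _ ≤ (b - c) ^ 2 * (x ^ 2 * D ^ 2) := by gcongr
    _ = x ^ 2 * ((b - c) ^ 2 * D ^ 2) := by ring
    _ ≤ x ^ 2 * (‖trendTransform mu T n v x‖ ^ 2 +
          lpNorm (windowKernel A0 T n v x) 2 bandMeasure ^ 2) := by
        gcongr
        linarith [sq_nonneg (lpNorm (windowKernel A0 T n v x) 2 bandMeasure)]
    _ = _ := by field_simp

lemma tendsto_fourierFreq_zero {n : ℕ → ℕ} {l : ℕ → ℤ} (hn : Tendsto n atTop atTop)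
    (h : Tendsto (fun T => (n T : ℝ) * fourierFreq (n T) (l T) ^ 2) atTop (𝓝 0)) :
    Tendsto (fun T => fourierFreq (n T) (l T)) atTop (𝓝 0) := by
  have h2 : Tendsto (fun T => fourierFreq (n T) (l T) ^ 2) atTop (𝓝 0) := by
    refine tendsto_of_tendsto_of_tendsto_of_le_of_le' tendsto_const_nhds h
      (Eventually.of_forall fun T => sq_nonneg _) ?_
    filter_upwards [hn.eventually_ge_atTop 1] with T hT
    exact le_mul_of_one_le_left (sq_nonneg _) (by exact_mod_cast hT)
  have h3 := (Real.continuous_sqrt.tendsto 0).comp h2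
  rw [Real.sqrt_zero] at h3
  rw [tendsto_zero_iff_abs_tendsto_zero]
  refine h3.congr fun T => ?_
  simp [Real.sqrt_sq_eq_abs]

lemma tendsto_const_mul_inv_atTop {c : ℝ} (hc : 0 < c) {g : ℕ → ℝ} (hg : Tendsto g atTop (𝓝 0))
    (hpos : ∀ᶠ T in atTop, 0 < g T) : Tendsto (fun T => c * (g T)⁻¹) atTop atTop :=
  (tendsto_inv_nhdsGT_zero.comp
    (tendsto_nhdsWithin_of_tendsto_nhds_of_eventually_within _ hg hpos)).const_mul_atTop hc

lemma exists_pos_le_abs_sub_int {y : ℝ} (h : ∀ k : ℤ, y ≠ k) :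
    ∃ ε > 0, ∀ k : ℤ, ε ≤ |y - k| :=
  ⟨|y - round y|, abs_pos.2 (sub_ne_zero.2 (h _)), fun k => round_le y k⟩

/-- Divergence of the mean periodogram at an interior break of the trend. -/
theorem IsSLS.tendsto_atTop_of_interior_break [IsProbabilityMeasure P]
    (hV : IsSLS P V lam A0 A mu) {n : ℕ → ℕ} (hn_even : ∀ T, Even (n T))
    (hn : Tendsto n atTop atTop) {u : ℕ → ℝ}
    (hwin : ∀ᶠ T : ℕ in atTop, window T (n T) (u T) ⊆ Set.Icc (1 : ℤ) (T : ℤ)) {j : Fin m₀}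
    (hj : ∀ᶠ T in atTop, breakDate lam T j ∈ window T (n T) (u T))
    (hmean : LocalMeanCondition lam mu n u) {γ : ℝ} (hγ : γ ∈ Set.Ioo (0 : ℝ) 1)
    (hpos : Tendsto (fun T => leftPosition lam T (n T) (u T) j) atTop (𝓝 γ)) :
    (∀ l : ℤ, (∀ k : ℤ, (l : ℝ) * γ ≠ (k : ℝ)) →
      Tendsto (fun T => meanLocalPeriodogram P V T (n T) (u T) (fourierFreq (n T) l))
        atTop atTop) ∧
    (∀ l : ℕ → ℤ, (∀ᶠ T in atTop, Admissible (n T) (l T)) →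
      Tendsto (fun T => (n T : ℝ) * fourierFreq (n T) (l T) ^ 2) atTop (𝓝 0) →
      (∃ ε > 0, ∀ᶠ T in atTop, ∀ k : ℤ,
        ε ≤ |(l T : ℝ) * leftPosition lam T (n T) (u T) j - (k : ℝ)|) →
      Tendsto (fun T => meanLocalPeriodogram P V T (n T) (u T) (fourierFreq (n T) (l T)))
        atTop atTop) ∧
    (∀ l : ℕ → ℤ, (∀ᶠ T in atTop, Admissible (n T) (l T) ∧ Admissible (n T) (l T + 1)) →
      Tendsto (fun T => (n T : ℝ) * fourierFreq (n T) (l T) ^ 2) atTop (𝓝 0) →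
      Tendsto (fun T => max
          (meanLocalPeriodogram P V T (n T) (u T) (fourierFreq (n T) (l T)))
          (meanLocalPeriodogram P V T (n T) (u T) (fourierFreq (n T) (l T + 1))))
        atTop atTop) := by
  obtain ⟨B, hBinj, hB⟩ := hmean
  have hpi := Real.pi_pos
  have hone := tendsto_one_div_length hn
  set β := B j.castSucc - B j.succ with hβ
  have hβ0 : β ≠ 0 := sub_ne_zero.2 fun h => (Fin.castSucc_lt_succ (i := j)).ne (hBinj h)
  -- The dates up to and including the break number T_j - a_T + 1, so the jump occurs at this
  -- fraction of the window; it exceeds the left position by 1/n.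
  set q : ℕ → ℝ := fun T => leftPosition lam T (n T) (u T) j + 1 / n T with hq
  have hqlim : Tendsto q atTop (𝓝 γ) := by
    have := hpos.add hone
    rwa [add_zero] at this
  have key : ∀ᶠ T in atTop, ∀ l : ℤ, Admissible (n T) l → ∀ ε : ℝ, 0 ≤ ε →
      (∀ i : ℤ, ε ≤ |(l : ℝ) * q T - i|) →
      16 * β ^ 2 * ε ^ 2 * (n T * fourierFreq (n T) l ^ 2)⁻¹ ≤
        meanLocalPeriodogram P V T (n T) (u T) (fourierFreq (n T) l) := by
    filter_upwards [hwin, hj, hB, hn.eventually_gt_atTop 0] with T hw hjT hBT hn0 l hl ε hε hdist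
    refine hV.meanLocalPeriodogram_ge_of_jump (hn_even T) hn0 hw hl
      (k := (breakDate lam T j - windowStart T (n T) (u T)).toNat + 1) ?_ ?_ (hBT j hjT l hl) hε ?_
    · simp only [window, Set.mem_Icc] at hjT
      omega
    · have := hn_even T
      obtain ⟨k, hk⟩ := this
      simp only [window, windowStart, Set.mem_Icc] at hjT ⊢
      omega
    · intro i
      have := hdist i
      simp only [hq] at this
      rw [leftPosition_eq hjT, ← add_div] at this
      exact_mod_cast this
  have freq_pos : ∀ T l, 0 < n T → Admissible (n T) l →
      0 < (n T : ℝ) * fourierFreq (n T) l ^ 2 := fun T l hn0 hl => by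
    have := hl.fourierFreq_ne_zero hn0
    have hn' : (0 : ℝ) < n T := by exact_mod_cast hn0
    positivity
  have seq : ∀ l : ℕ → ℤ, (∀ᶠ T in atTop, Admissible (n T) (l T)) →
      Tendsto (fun T => (n T : ℝ) * fourierFreq (n T) (l T) ^ 2) atTop (𝓝 0) →
      (∃ ε > 0, ∀ᶠ T in atTop, ∀ k : ℤ,
        ε ≤ |(l T : ℝ) * leftPosition lam T (n T) (u T) j - (k : ℝ)|) →
      Tendsto (fun T => meanLocalPeriodogram P V T (n T) (u T) (fourierFreq (n T) (l T)))
        atTop atTop := by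
    rintro l hl hω ⟨ε, hε, hdist⟩
    -- Passing from the left position to `q` shifts the phase by l/n = ω/(2π), which tends to zero;
    -- half of ε is reserved for it.
    have hln : Tendsto (fun T => |(l T : ℝ) * (1 / n T)|) atTop (𝓝 0) := by
      have := ((tendsto_fourierFreq_zero hn hω).const_mul (1 / (2 * Real.pi))).abs
      rw [mul_zero, abs_zero] at this
      refine this.congr fun T => ?_
      congr 1
      unfold fourierFreq
      field_simp
    refine tendsto_atTop_mono' _ ?_ (tendsto_const_mul_inv_atTop
      (c := 16 * β ^ 2 * (ε / 2) ^ 2) (by positivity) hω ?_)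
    · filter_upwards [key, hl, hdist, hln.eventually_lt_const (half_pos hε)] with T hk hlT hdT hlnT
      refine hk (l T) hlT (ε / 2) (half_pos hε).le fun i => ?_
      have h1 := hdT i
      have h2 : (l T : ℝ) * leftPosition lam T (n T) (u T) j - i
          = ((l T : ℝ) * q T - i) - (l T : ℝ) * (1 / n T) := by
        simp only [hq]
        ring
      rw [h2] at h1
      have h3 := abs_sub ((l T : ℝ) * q T - i) ((l T : ℝ) * (1 / n T))
      linarith
    · filter_upwards [hl, hn.eventually_gt_atTop 0] with T hlT hn0
      exact freq_pos T _ hn0 hlT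
  refine ⟨fun l hlγ => ?_, seq, fun l hl hω => ?_⟩
  · have hl0 : l ≠ 0 := by
      rintro rfl
      exact hlγ 0 (by simp)
    have hω : Tendsto (fun T => (n T : ℝ) * fourierFreq (n T) l ^ 2) atTop (𝓝 0) := by
      have := hone.const_mul ((2 * Real.pi * l) ^ 2)
      rw [mul_zero] at this
      refine this.congr' ?_
      filter_upwards [hn.eventually_gt_atTop 0] with T hn0
      have hn' : (n T : ℝ) ≠ 0 := by exact_mod_cast hn0.ne'
      unfold fourierFreq
      field_simp
    refine seq (fun _ => l) ?_ hω ?_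
    · have h1 := (tendsto_fourierFreq_zero (l := fun _ => l) hn hω).eventually
        (Ioo_mem_nhds (neg_lt_zero.2 hpi) hpi)
      filter_upwards [h1, hn.eventually_gt_atTop l.natAbs] with T h1 h2
      refine ⟨fun hdvd => ?_, h1⟩
      have := Nat.le_of_dvd (Int.natAbs_pos.2 hl0) (Int.natCast_dvd.1 hdvd)
      omega
    · obtain ⟨ε, hε, hdist⟩ := exists_pos_le_abs_sub_int hlγ
      refine ⟨ε / 2, half_pos hε, ?_⟩
      have h1 : Tendsto (fun T => |(l : ℝ) * leftPosition lam T (n T) (u T) j - l * γ|) atTop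
          (𝓝 0) := by
        simpa using ((hpos.const_mul (l : ℝ)).sub_const ((l : ℝ) * γ)).abs
      filter_upwards [h1.eventually_lt_const (half_pos hε)] with T hT k
      have h2 := hdist k
      have h3 := abs_sub_le ((l : ℝ) * γ) (l * leftPosition lam T (n T) (u T) j) k
      rw [abs_sub_comm ((l : ℝ) * γ) (_ * _)] at h3
      linarith
  · have hω' : Tendsto (fun T => (n T : ℝ) * fourierFreq (n T) (l T + 1) ^ 2) atTop (𝓝 0) := by
      -- The neighbouring frequency is ω + 2π/n, and (ω + δ)² ≤ 2ω² + 2δ².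
      have hlim := (hω.const_mul 2).add (hone.const_mul (2 * (2 * Real.pi) ^ 2))
      rw [mul_zero, mul_zero, add_zero] at hlim
      refine squeeze_zero' (Eventually.of_forall fun T => by positivity) ?_ hlim
      filter_upwards [hn.eventually_gt_atTop 0] with T hn0
      have hn' : (0 : ℝ) < n T := by exact_mod_cast hn0
      have h1 : fourierFreq (n T) (l T + 1) = fourierFreq (n T) (l T) + 2 * Real.pi / n T := by
        unfold fourierFreq
        push_cast
        ring
      have h2 : 2 * (2 * Real.pi) ^ 2 * (1 / (n T : ℝ)) = n T * (2 * (2 * Real.pi / n T) ^ 2) := by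
        field_simp
      rw [h1, h2]
      nlinarith [sq_nonneg (fourierFreq (n T) (l T) - 2 * Real.pi / n T),
        mul_nonneg hn'.le (sq_nonneg (fourierFreq (n T) (l T) - 2 * Real.pi / n T))]
    obtain ⟨ε, hε, hdist⟩ := exists_pos_le_abs_sub_int (y := γ) (fun k hk => by
      rw [hk] at hγ
      have h1 : (0 : ℤ) < k := by exact_mod_cast hγ.1
      have h2 : k < (1 : ℤ) := by exact_mod_cast hγ.2
      omega)
    have hqγ : Tendsto (fun T => |q T - γ|) atTop (𝓝 0) := by
      simpa using (hqlim.sub_const γ).abs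
    -- The sum of both denominators gives one lower bound valid whichever of the two frequencies is
    -- used.
    have hsum : Tendsto (fun T => (n T : ℝ) * fourierFreq (n T) (l T) ^ 2 +
        (n T : ℝ) * fourierFreq (n T) (l T + 1) ^ 2) atTop (𝓝 0) := by simpa using hω.add hω'
    refine tendsto_atTop_mono' _ ?_ (tendsto_const_mul_inv_atTop
      (c := 16 * β ^ 2 * (ε / 4) ^ 2) (by positivity) hsum ?_)
    · filter_upwards [key, hl, hqγ.eventually_lt_const (half_pos hε), hn.eventually_gt_atTop 0]
        with T hk ⟨hl1, hl2⟩ hqT hn0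
      have p1 := freq_pos T _ hn0 hl1
      have p2 := freq_pos T _ hn0 hl2
      -- If both phases were within ε/4 of integers, their difference `q` would be within ε/2 of an
      -- integer; as |q - γ| < ε/2, so would γ be within ε, contrary to the choice of ε.
      by_cases hc : ∀ i : ℤ, ε / 4 ≤ |(l T : ℝ) * q T - i|
      · refine le_trans ?_ ((hk _ hl1 _ (by positivity) hc).trans (le_max_left _ _))
        gcongr
        linarith
      · push Not at hc
        obtain ⟨i, hi⟩ := hc
        refine le_trans ?_ ((hk _ hl2 (ε / 4) (by positivity) fun i' => ?_).trans
          (le_max_right _ _))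
        · gcongr
          linarith
        · by_contra! hcon
          have h1 := hdist (i' - i)
          have h2 : γ - ((i' - i : ℤ) : ℝ) = (((l T + 1 : ℤ) : ℝ) * q T - i') -
              ((l T : ℝ) * q T - i) - (q T - γ) := by
            push_cast
            ring
          rw [h2] at h1
          have h3 := abs_sub (((l T + 1 : ℤ) : ℝ) * q T - i' - ((l T : ℝ) * q T - i)) (q T - γ)
          have h4 := abs_sub (((l T + 1 : ℤ) : ℝ) * q T - i') ((l T : ℝ) * q T - i)
          linarith
    · filter_upwards [hl, hn.eventually_gt_atTop 0] with T hlT hn0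
      exact add_pos (freq_pos T _ hn0 hlT.1) (freq_pos T _ hn0 hlT.2)

end Divergence

end LocalPeriodogram

/-! ### The main theorem -/

open LocalPeriodogram in
theorem mainTheorem4 {Ω : Type*} [MeasurableSpace Ω] (P : Measure Ω) [IsProbabilityMeasure P]
    {m₀ : ℕ} (V : ℕ → ℤ → Ω → ℝ) (lam : Fin (m₀ + 2) → ℝ)
    (A0 : ℕ → ℤ → ℝ → ℂ) (A : ℝ → ℝ → ℂ) (mu : ℝ → ℝ)
    (hV : IsSLS P V lam A0 A mu) (hA : SmoothTransfer lam A)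
    (n : ℕ → ℕ) (hn_even : ∀ T, Even (n T)) (hn : Tendsto n atTop atTop)
    (hnT : Tendsto (fun T : ℕ => (n T : ℝ) / (T : ℝ)) atTop (𝓝 0))
    (u : ℕ → ℝ) (hu : ∀ T, u T ∈ Set.Ioo (0 : ℝ) 1)
    (hwin : ∀ᶠ T : ℕ in atTop, window T (n T) (u T) ⊆ Set.Icc (1 : ℤ) (T : ℤ)) :
    -- (i) no break in the window
    ((∀ᶠ T in atTop, ∀ j : Fin m₀, breakDate lam T j ∉ window T (n T) (u T)) →
      BoundedBelowBySpecDensity P V A n u) ∧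
    -- (ii) a break in the window
    (∀ j : Fin m₀, (∀ᶠ T in atTop, breakDate lam T j ∈ window T (n T) (u T)) →
      -- (a) at an interior fraction of the window
      (∀ γ ∈ Set.Ioo (0 : ℝ) 1, LocalMeanCondition lam mu n u →
        (Tendsto (fun T => leftPosition lam T (n T) (u T) j) atTop (𝓝 γ) ∨
          Tendsto (fun T => rightPosition lam T (n T) (u T) j) atTop (𝓝 γ)) →
        -- each fixed index `l` with `l γ` not an integer
        (∀ l : ℤ, (∀ k : ℤ, (l : ℝ) * γ ≠ (k : ℝ)) →
          Tendsto (fun T => meanLocalPeriodogram P V T (n T) (u T) (fourierFreq (n T) l))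
            atTop atTop) ∧
        -- each sequence of indices whose phase stays away from the integers
        (∀ l : ℕ → ℤ, (∀ᶠ T in atTop, Admissible (n T) (l T)) →
          Tendsto (fun T => (n T : ℝ) * fourierFreq (n T) (l T) ^ 2) atTop (𝓝 0) →
          (∃ ε > 0, ∀ᶠ T in atTop, ∀ k : ℤ,
            ε ≤ |(l T : ℝ) * leftPosition lam T (n T) (u T) j - (k : ℝ)|) →
          Tendsto (fun T => meanLocalPeriodogram P V T (n T) (u T) (fourierFreq (n T) (l T)))
            atTop atTop) ∧
        -- at least one of any two neighbouring frequencies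
        (∀ l : ℕ → ℤ, (∀ᶠ T in atTop, Admissible (n T) (l T) ∧ Admissible (n T) (l T + 1)) →
          Tendsto (fun T => (n T : ℝ) * fourierFreq (n T) (l T) ^ 2) atTop (𝓝 0) →
          Tendsto (fun T => max
              (meanLocalPeriodogram P V T (n T) (u T) (fourierFreq (n T) (l T)))
              (meanLocalPeriodogram P V T (n T) (u T) (fourierFreq (n T) (l T + 1))))
            atTop atTop)) ∧
      -- (b) near the boundary of the window
      ((Tendsto (fun T => leftPosition lam T (n T) (u T) j) atTop (𝓝 0) ∨
          Tendsto (fun T => rightPosition lam T (n T) (u T) j) atTop (𝓝 0)) →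
        BoundedBelowBySpecDensity P V A n u)) := by
  refine ⟨hV.boundedBelow_of_no_break hA hn_even hn hnT hu hwin, fun j hj => ⟨?_, fun hpos =>
    hV.boundedBelow_of_boundary_break hA hn_even hn hnT hu hwin hj hpos⟩⟩
  rintro γ hγ hmean (hpos | hpos)
  · exact hV.tendsto_atTop_of_interior_break hn_even hn hwin hj hmean hγ hpos
  · have hleft : Tendsto (fun T => leftPosition lam T (n T) (u T) j) atTop (𝓝 (1 - γ)) := by
      refine (hpos.const_sub 1).congr' ?_
      filter_upwards [hn.eventually_gt_atTop 0] with T hn0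
      rw [rightPosition_eq (hn_even T) hn0, sub_sub_cancel]
    obtain ⟨h1, h2⟩ := hV.tendsto_atTop_of_interior_break hn_even hn hwin hj hmean
      (γ := 1 - γ) ⟨by linarith [hγ.2], by linarith [hγ.1]⟩ hleft
    -- The break sits at 1 - γ from the left, and l(1 - γ) is an integer exactly when lγ is.
    refine ⟨fun l hl => h1 l fun k hk => hl (l - k) ?_, h2⟩
    push_cast
    linarith
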